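/- Let $\mathcal X$ be a measurable space and $k:\mathcal X\times\mathcal X\to\mathbb R$ a measurable positive semidefinite kernel with reproducing kernel Hilbert space $\mathcal H$ (a Hilbert space of functions $\mathcal X\to\mathbb R$), and assume $\kappa=\sup_{x\in\mathcal X}k(x,x)<\infty$. Let $\mathcal Y\subset\mathbb R$, let $n\ge 1$, and let $(X_1,Y_1),\dots,(X_n,Y_n)$ be i.i.d. examples from a probability distribution $P$ on $\mathcal X\times\mathcal Y$. Put $\boldsymbol Y=(Y_1,\dots,Y_n)^\top$ and $K=(k(X_i,X_j))_{i,j=1}^n$, and assume that $K$ has full rank almost surely. Let $\ell:\mathbb R\times\mathcal Y\to\mathbb R$ be a loss function with $\ell(u,y)\ge 0$ for all $u\in\mathbb R$, $y\in\mathcal Y$, and $\ell(y,y)=0$ for all $y\in\mathcal Y$. Let $\lambda>0$, $\gamma>0$, $\delta>0$, let $\phi_\gamma$ be the margin loss, $\phi_\gamma(\alpha)=1$ for $\alpha\le 0$, $\phi_\gamma(\alpha)=1-\alpha/\gamma$ for $0<\alpha\le\gamma$, $\phi_\gamma(\alpha)=0$ for $\alpha>\gamma$, and let $M_0=\left\lceil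 \gamma\sqrt n/(2\sqrt\kappa)\right\rceil$. Then, with probability at least $1-\delta$ over the sample, every minimizer $$f^*\in\operatorname*{arg\,min}_{f\in\mathcal H}\ \frac1n\sum_{i=1}^n\ell(f(X_i),Y_i)+\frac\lambda2\|f\|_{\mathcal H}^2$$ satisfies $$\mathbb P_{(X,Y)\sim P}\big(Yf^*(X)\le 0\big)\le\frac1n\sum_{i=1}^n\phi_\gamma\big(\operatorname{sign}(Y_i)f^*(X_i)\big)+\frac{2\sqrt{\boldsymbol Y^\top K^{-1}\boldsymbol Y}+2}{\gamma n}\sqrt{\operatorname{tr}(K)}+3\sqrt{\frac{\ln(2M_0/\delta)}{2n}}.$$ -/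

import Mathlib

open MeasureTheory ProbabilityTheory Matrix

/-- `H` is the reproducing kernel Hilbert space of the scalar kernel `k`: the reproducing kernel of
the Hilbert space of functions `H`, an operator `ℝ →L[ℝ] ℝ` for each pair of points, is
multiplication by `k x x'`. -/
def IsRKHSOfKernel (H : Type*) {𝒳 : Type*} [NormedAddCommGroup H] [InnerProductSpace ℝ H]
    [CompleteSpace H] [RKHS ℝ H 𝒳 ℝ] (k : 𝒳 → 𝒳 → ℝ) : Prop :=
  ∀ x x' : 𝒳, RKHS.kernel H x x' (1 : ℝ) = k x x'

/-- The kernel matrix `K i j = k (x i) (x j)`. -/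
def kernelMatrix {𝒳 : Type*} (k : 𝒳 → 𝒳 → ℝ) {n : ℕ} (x : Fin n → 𝒳) :
    Matrix (Fin n) (Fin n) ℝ :=
  Matrix.of fun i j => k (x i) (x j)

/-- The margin loss with scale `γ`. -/
noncomputable def marginLoss (γ α : ℝ) : ℝ :=
  if α ≤ 0 then 1 else if α ≤ γ then 1 - α / γ else 0

/-- The regularized empirical loss of `f` on the sample `(x i, y i)`. -/
noncomputable def regularizedLoss {H 𝒳 : Type*} [NormedAddCommGroup H] [InnerProductSpace ℝ H]
    [RKHS ℝ H 𝒳 ℝ] (ℓ : ℝ → ℝ → ℝ) (lam : ℝ) {n : ℕ} (x : Fin n → 𝒳) (y : Fin n → ℝ)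
    (f : H) : ℝ :=
  (1 / (n : ℝ)) * ∑ i, ℓ (f (x i)) (y i) + lam / 2 * ‖f‖ ^ 2

/-- `f` minimizes the regularized empirical loss over the whole space `H`. -/
def IsKernelSolution {H 𝒳 : Type*} [NormedAddCommGroup H] [InnerProductSpace ℝ H]
    [RKHS ℝ H 𝒳 ℝ] (ℓ : ℝ → ℝ → ℝ) (lam : ℝ) {n : ℕ} (x : Fin n → 𝒳) (y : Fin n → ℝ)
    (f : H) : Prop :=
  ∀ g : H, regularizedLoss ℓ lam x y f ≤ regularizedLoss ℓ lam x y g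

/-! Everything follows from one event that is uniform in `f : H`. Let the ramp be one minus the
margin loss. For `δ < 1`, outside probability `δ`, the sample mean of the ramp exceeds its
expectation by at most `2‖f‖√(tr K)/(γn) + 3a`, with `a = √(log(2/δ)/(2n))`
(`IsRKHSOfKernel.exists_uniform_margin_bound`). A minimizer has norm at most `√(YᵀK⁻¹Y)`, because
the minimum-norm interpolant of the labels has zero loss. The summand `2` and the factor `M₀ ≥ 1` of
the theorem are then pure slack.

Uniformity in `‖f‖` is obtained by peeling over balls. To avoid paying a logarithm for the union,
the expected supremum over a ball needs a constant below the `2` of ordinary symmetrization. The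
sample is therefore compared with a ghost sample a hundred times larger. The weights `1/n` and
`-1/m` amount to sampling without replacement, and `le_bernoulliMean_of_symmetric` dominates this by
independent centred Bernoulli weights, up to the factor `1 - √c/2` with `c = 1/n + 1/m`.
`two_point_contraction` removes the ramp for these asymmetric weights, and the width of a Hilbert
ball is a second moment computation. The resulting constant is `6/5`. Its gap to `2` grows linearly
along the shells, so the tails from McDiarmid's inequality sum to at most `exp(-2na²)`.

The width involves an expectation of `k(x,x)`, whereas the bound involves the sample trace.
`exists_truncation` discards mass `a` of the largest diagonal values. Hoeffding's inequality for the
capped diagonal shows that the trace dominates `n` times the remaining expectation `V`, except with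
probability `exp(-2na²)`. The discarded mass costs one of the three `a`. The two failure
probabilities add up to `δ`. If `√n ≤ 2 + 3√n·a`, the bound is deterministic, by Cauchy–Schwarz. -/

/-! ### Exponential moments under bounded differences -/

/-- Reindexing the coordinates preserves a power of a probability measure. -/
theorem measurePreserving_comp_equiv {ι ι' 𝒵 : Type*} [Fintype ι] [Fintype ι'] [MeasurableSpace 𝒵]
    (P : Measure 𝒵) [IsProbabilityMeasure P] (e : ι ≃ ι') :
    MeasurePreserving (fun z : ι' → 𝒵 => z ∘ e) (Measure.pi fun _ => P)
      (Measure.pi fun _ => P) := by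
  have h := measurePreserving_piCongrLeft (fun _ : ι => P) e.symm
  convert h using 1
  ext z i
  have := MeasurableEquiv.piCongrLeft_apply_apply (β := fun _ : ι => 𝒵) e.symm z (e i)
  simpa using this.symm

theorem integrable_of_forall_abs_le {α : Type*} [MeasurableSpace α] {μ : Measure α}
    [IsFiniteMeasure μ] {F : α → ℝ} (hF : Measurable F) {C : ℝ} (hC : ∀ z, |F z| ≤ C) :
    Integrable F μ :=
  Integrable.of_bound hF.aestronglyMeasurable C (Filter.Eventually.of_forall hC)

theorem integrable_exp_mul_of_forall_abs_le {α : Type*} [MeasurableSpace α] {μ : Measure α}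
    [IsFiniteMeasure μ] {F : α → ℝ} (hF : Measurable F) {C : ℝ} (hC : ∀ z, |F z| ≤ C) (t : ℝ) :
    Integrable (fun z => Real.exp (t * F z)) μ := by
  refine integrable_of_forall_abs_le (C := Real.exp (|t| * C)) (by fun_prop) fun z => ?_
  rw [abs_of_pos (Real.exp_pos _)]
  refine Real.exp_le_exp.2 ((le_abs_self _).trans ?_)
  rw [abs_mul]
  exact mul_le_mul_of_nonneg_left (hC z) (abs_nonneg _)

/-- Hoeffding's lemma for a function of bounded oscillation. -/
theorem integral_exp_le_of_oscillation {𝒵 : Type*} [MeasurableSpace 𝒵] (P : Measure 𝒵)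
    [IsProbabilityMeasure P] {G : 𝒵 → ℝ} (hG : Measurable G) {C : ℝ} (hC : ∀ x, |G x| ≤ C)
    {c : ℝ} (hc : ∀ x y, G x - G y ≤ c) (t : ℝ) :
    ∫ x, Real.exp (t * G x) ∂P ≤ Real.exp (t * ∫ x, G x ∂P + t ^ 2 * c ^ 2 / 8) := by
  have hne : Nonempty 𝒵 := nonempty_of_isProbabilityMeasure P
  have hbdd : BddBelow (Set.range G) := ⟨-C, by rintro _ ⟨x, rfl⟩; exact neg_le_of_abs_le (hC x)⟩
  have hmem : ∀ x, G x ∈ Set.Icc (⨅ y, G y) ((⨅ y, G y) + c) := fun x =>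
    ⟨ciInf_le hbdd x, by
      have : G x - c ≤ ⨅ y, G y := le_ciInf fun y => by linarith [hc x y]
      linarith⟩
  have h := (hasSubgaussianMGF_of_mem_Icc (μ := P) hG.aemeasurable
    (Filter.Eventually.of_forall hmem)).mgf_le t
  have hI : ∫ x, Real.exp (t * G x) ∂P
      = Real.exp (t * ∫ x, G x ∂P) * mgf (fun x => G x - ∫ y, G y ∂P) P t := by
    rw [mgf, ← integral_const_mul]
    refine integral_congr_ae (Filter.Eventually.of_forall fun x => ?_)
    simp only
    rw [← Real.exp_add]
    ring_nf
  rw [hI, Real.exp_add]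
  refine mul_le_mul_of_nonneg_left (h.trans (le_of_eq ?_)) (Real.exp_pos _).le
  congr 1
  simp only [add_sub_cancel_left, NNReal.coe_pow, NNReal.coe_div, coe_nnnorm, NNReal.coe_ofNat,
    Real.norm_eq_abs, div_pow, sq_abs]
  ring

/-- Induction by conditioning on the first coordinate. The inner integral is controlled by the
induction hypothesis. The conditional mean inherits the oscillation `c 0`, so Hoeffding's lemma
handles the outer integral. -/
theorem integral_exp_le_of_bounded_differences_fin {𝒵 : Type*} [MeasurableSpace 𝒵]
    (P : Measure 𝒵) [IsProbabilityMeasure P] {C : ℝ} (t : ℝ) :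
    ∀ {N : ℕ} {F : (Fin N → 𝒵) → ℝ} (_ : Measurable F) (_ : ∀ z, |F z| ≤ C)
      {c : Fin N → ℝ} (_ : ∀ i z x, F (Function.update z i x) - F z ≤ c i),
      ∫ z, Real.exp (t * F z) ∂(Measure.pi fun _ => P)
        ≤ Real.exp (t * ∫ z, F z ∂(Measure.pi fun _ => P) + t ^ 2 * (∑ i, c i ^ 2) / 8)
  | 0, F, hF, hC, c, hc => by
      have hz : ∀ z : Fin 0 → 𝒵, z = Fin.elim0 := fun z => Subsingleton.elim _ _
      have h1 : ∀ z, F z = F Fin.elim0 := fun z => by rw [hz z]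
      simp [h1]
  | N + 1, F, hF, hC, c, hc => by
      have hmp := (measurePreserving_piFinSuccAbove (fun _ : Fin (N + 1) => P) 0).symm
      have happ : ∀ p : 𝒵 × (Fin N → 𝒵),
          (MeasurableEquiv.piFinSuccAbove (fun _ => 𝒵) 0).symm p = Fin.cons p.1 p.2 := fun p => by
        simp [MeasurableEquiv.piFinSuccAbove_symm_apply, Fin.insertNthEquiv]
      have hcons : Measurable fun p : 𝒵 × (Fin N → 𝒵) => F (Fin.cons p.1 p.2) := by
        have := hF.comp hmp.measurable
        simpa only [Function.comp_def, happ] using this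
      have hint : ∀ G : (Fin (N + 1) → 𝒵) → ℝ,
          ∫ z, G z ∂(Measure.pi fun _ => P)
            = ∫ p : 𝒵 × (Fin N → 𝒵), G (Fin.cons p.1 p.2) ∂(P.prod (Measure.pi fun _ => P)) := by
        intro G
        rw [← hmp.integral_comp']
        simp only [happ]
      have hsec : ∀ x, Measurable fun z : Fin N → 𝒵 => F (Fin.cons x z) := fun x =>
        hcons.comp measurable_prodMk_left
      have hFi : Integrable (fun p : 𝒵 × (Fin N → 𝒵) => F (Fin.cons p.1 p.2))
          (P.prod (Measure.pi fun _ => P)) := integrable_of_forall_abs_le hcons fun p => hC _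
      have hEi := integrable_exp_mul_of_forall_abs_le (μ := P.prod (Measure.pi fun _ : Fin N => P))
        hcons (fun p => hC _) t
      set G : 𝒵 → ℝ := fun x => ∫ z, F (Fin.cons x z) ∂(Measure.pi fun _ : Fin N => P) with hGdef
      have hGm : Measurable G :=
        (hcons.stronglyMeasurable.integral_prod_right).measurable
      have hGC : ∀ x, |G x| ≤ C := fun x => by
        have := norm_integral_le_of_norm_le_const (μ := Measure.pi fun _ : Fin N => P)
          (f := fun z => F (Fin.cons x z)) (C := C)
          (Filter.Eventually.of_forall fun z => hC _)
        simpa using this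
      have hGc : ∀ x y, G x - G y ≤ c 0 := fun x y => by
        rw [hGdef]
        simp only
        rw [← integral_sub (integrable_of_forall_abs_le (hsec x) fun z => hC _)
          (integrable_of_forall_abs_le (hsec y) fun z => hC _)]
        have : ∀ z : Fin N → 𝒵, F (Fin.cons x z) - F (Fin.cons y z) ≤ c 0 := fun z => by
          have := hc 0 (Fin.cons y z) x
          rwa [Fin.update_cons_zero] at this
        refine (integral_mono ((integrable_of_forall_abs_le (hsec x) fun z => hC _).sub
          (integrable_of_forall_abs_le (hsec y) fun z => hC _)) (integrable_const (c 0)) this).trans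
          (by simp)
      rw [hint, hint, integral_prod _ hEi, integral_prod _ hFi, Fin.sum_univ_succ]
      have step : ∀ x, ∫ z, Real.exp (t * F (Fin.cons x z)) ∂(Measure.pi fun _ : Fin N => P)
          ≤ Real.exp (t * G x) * Real.exp (t ^ 2 * (∑ i : Fin N, c i.succ ^ 2) / 8) := fun x => by
        rw [← Real.exp_add]
        refine integral_exp_le_of_bounded_differences_fin P t (hsec x) (fun z => hC _)
          (c := fun i => c i.succ) fun i z y => ?_
        have := hc i.succ (Fin.cons x z) y
        rwa [← Fin.cons_update] at this
      calc ∫ x, ∫ z, Real.exp (t * F (Fin.cons x z)) ∂(Measure.pi fun _ : Fin N => P) ∂P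
          ≤ ∫ x, Real.exp (t * G x) * Real.exp (t ^ 2 * (∑ i : Fin N, c i.succ ^ 2) / 8) ∂P :=
            integral_mono hEi.integral_prod_left
              ((integrable_exp_mul_of_forall_abs_le hGm hGC t).mul_const _) step
        _ = (∫ x, Real.exp (t * G x) ∂P) * Real.exp (t ^ 2 * (∑ i : Fin N, c i.succ ^ 2) / 8) :=
            integral_mul_const _ _
        _ ≤ Real.exp (t * ∫ x, G x ∂P + t ^ 2 * c 0 ^ 2 / 8)
              * Real.exp (t ^ 2 * (∑ i : Fin N, c i.succ ^ 2) / 8) :=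
            mul_le_mul_of_nonneg_right (integral_exp_le_of_oscillation P hGm hGC hGc t)
              (Real.exp_pos _).le
        _ = _ := by
            rw [← Real.exp_add]
            congr 1
            ring

/-- McDiarmid's inequality, in exponential moment form: a bounded function of independent
coordinates with bounded differences is subgaussian. -/
theorem integral_exp_le_of_bounded_differences {ι 𝒵 : Type*} [Fintype ι] [DecidableEq ι]
    [MeasurableSpace 𝒵] (P : Measure 𝒵) [IsProbabilityMeasure P] {F : (ι → 𝒵) → ℝ}
    (hF : Measurable F) {C : ℝ} (hC : ∀ z, |F z| ≤ C) {c : ι → ℝ}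
    (hc : ∀ i z x, F (Function.update z i x) - F z ≤ c i) (t : ℝ) :
    ∫ z, Real.exp (t * F z) ∂(Measure.pi fun _ => P)
      ≤ Real.exp (t * ∫ z, F z ∂(Measure.pi fun _ => P) + t ^ 2 * (∑ i, c i ^ 2) / 8) := by
  classical
  let e := Fintype.equivFin ι
  have hmp := measurePreserving_comp_equiv (𝒵 := 𝒵) P e
  have h := integral_exp_le_of_bounded_differences_fin P t (hF.comp hmp.measurable)
    (fun z => hC _) (c := fun i => c (e.symm i)) fun i z x => by
      have := hc (e.symm i) (z ∘ e) x
      simp only [Function.comp_def] at this ⊢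
      convert this using 3
      ext j
      by_cases hj : j = e.symm i
      · subst hj; simp
      · rw [Function.update_of_ne hj, Function.update_of_ne]
        intro h; exact hj (by rw [← h]; simp)
  have hme : ∀ G : (ι → 𝒵) → ℝ, Measurable G →
      ∫ z, G (z ∘ e) ∂(Measure.pi fun _ => P) = ∫ z, G z ∂(Measure.pi fun _ => P) := by
    intro G hG
    rw [← hmp.map_eq, integral_map hmp.measurable.aemeasurable hG.aestronglyMeasurable]
  have h1 := hme F hF
  have h2 := hme (fun z => Real.exp (t * F z)) (by fun_prop)
  have h3 : ∑ i, c (e.symm i) ^ 2 = ∑ i, c i ^ 2 := Equiv.sum_comp e.symm fun i => c i ^ 2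
  simp only [Function.comp_def] at h h1 h2
  rw [h1, h2, h3] at h
  exact h

/-! ### Centred Bernoulli weights: moments, contraction, width of a ball -/

/-- The expectation of `F` at a vector of `N` independent centred Bernoulli variables, each equal
to `1 - p` with probability `p` and to `-p` with probability `1 - p`. -/
noncomputable def bernoulliMean (p : ℝ) : (N : ℕ) → ((Fin N → ℝ) → ℝ) → ℝ
  | 0, F => F Fin.elim0
  | N + 1, F => p * bernoulliMean p N (fun v => F (Fin.cons (1 - p) v))
      + (1 - p) * bernoulliMean p N (fun v => F (Fin.cons (-p) v))

section BernoulliMean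

variable {p : ℝ}

theorem bernoulliMean_mono (hp0 : 0 ≤ p) (hp1 : p ≤ 1) : ∀ {N : ℕ} {F G : (Fin N → ℝ) → ℝ}
    (_ : ∀ v, (∀ i, v i = 1 - p ∨ v i = -p) → F v ≤ G v),
    bernoulliMean p N F ≤ bernoulliMean p N G
  | 0, F, G, h => h _ fun i => i.elim0
  | N + 1, F, G, h => by
      refine add_le_add (mul_le_mul_of_nonneg_left (bernoulliMean_mono hp0 hp1 fun v hv => h _ ?_)
        hp0) (mul_le_mul_of_nonneg_left (bernoulliMean_mono hp0 hp1 fun v hv => h _ ?_)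
        (sub_nonneg.2 hp1)) <;>
      · intro i
        refine Fin.cases ?_ (fun j => ?_) i
        · simp
        · simpa using hv j

theorem bernoulliMean_const (c : ℝ) : ∀ N : ℕ, bernoulliMean p N (fun _ => c) = c
  | 0 => rfl
  | N + 1 => by simp only [bernoulliMean, bernoulliMean_const c N]; ring

theorem bernoulliMean_add : ∀ {N : ℕ} (F G : (Fin N → ℝ) → ℝ),
    bernoulliMean p N (fun v => F v + G v) = bernoulliMean p N F + bernoulliMean p N G
  | 0, _, _ => rfl
  | N + 1, F, G => by
      simp only [bernoulliMean, bernoulliMean_add (fun v => F (Fin.cons (1 - p) v)),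
        bernoulliMean_add (fun v => F (Fin.cons (-p) v))]
      ring

theorem bernoulliMean_const_mul (c : ℝ) : ∀ {N : ℕ} (F : (Fin N → ℝ) → ℝ),
    bernoulliMean p N (fun v => c * F v) = c * bernoulliMean p N F
  | 0, _ => rfl
  | N + 1, F => by
      simp only [bernoulliMean, bernoulliMean_const_mul c (fun v => F (Fin.cons (1 - p) v)),
        bernoulliMean_const_mul c (fun v => F (Fin.cons (-p) v))]
      ring

theorem bernoulliMean_sum : ∀ N : ℕ, bernoulliMean p N (fun v => ∑ i, v i) = 0
  | 0 => by simp [bernoulliMean]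
  | N + 1 => by
      simp only [bernoulliMean, Fin.sum_univ_succ, Fin.cons_zero, Fin.cons_succ,
        bernoulliMean_add (fun _ => _) (fun v => ∑ i, v i), bernoulliMean_const,
        bernoulliMean_sum N]
      ring

/-- Each weight has mean zero and variance `p(1-p)`, so cross terms vanish. The offset `c` absorbs
the first summand in the induction. -/
theorem bernoulliMean_norm_sq {E : Type*} [NormedAddCommGroup E] [InnerProductSpace ℝ E] :
    ∀ {N : ℕ} (c : E) (x : Fin N → E),
      bernoulliMean p N (fun v => ‖c + ∑ i, v i • x i‖ ^ 2)
        = ‖c‖ ^ 2 + p * (1 - p) * ∑ i, ‖x i‖ ^ 2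
  | 0, c, x => by simp [bernoulliMean]
  | N + 1, c, x => by
      simp only [bernoulliMean, Fin.sum_univ_succ, Fin.cons_zero, Fin.cons_succ, ← add_assoc,
        bernoulliMean_norm_sq _ fun i => x i.succ]
      simp only [norm_add_sq_real, norm_smul, inner_smul_right, mul_pow, Real.norm_eq_abs, sq_abs]
      ring

/-- Jensen through `F ≤ r/2 + F²/(2r)` with `r` slightly above `√s`; the extra `ε` covers `s = 0`.
-/
theorem bernoulliMean_le_sqrt (hp0 : 0 ≤ p) (hp1 : p ≤ 1) {N : ℕ} (F : (Fin N → ℝ) → ℝ)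
    {s : ℝ} (hs : bernoulliMean p N (fun v => F v ^ 2) ≤ s) : bernoulliMean p N F ≤ √s := by
  have key : ∀ r : ℝ, 0 < r → s ≤ r ^ 2 → bernoulliMean p N F ≤ r := fun r hr hsr => by
    have h : bernoulliMean p N F
        ≤ bernoulliMean p N (fun v => r / 2 + (1 / (2 * r)) * F v ^ 2) :=
      bernoulliMean_mono hp0 hp1 fun v _ => by
        have : r / 2 + (1 / (2 * r)) * F v ^ 2 - F v = (F v - r) ^ 2 / (2 * r) := by
          field_simp
          ring
        have h2 : 0 ≤ (F v - r) ^ 2 / (2 * r) := by positivity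
        linarith
    rw [bernoulliMean_add, bernoulliMean_const, bernoulliMean_const_mul] at h
    have h2 : 1 / (2 * r) * bernoulliMean p N (fun v => F v ^ 2) ≤ 1 / (2 * r) * r ^ 2 :=
      mul_le_mul_of_nonneg_left (hs.trans hsr) (by positivity)
    have h3 : 1 / (2 * r) * r ^ 2 = r / 2 := by field_simp
    linarith
  refine le_of_forall_pos_le_add fun ε hε => key _ (by positivity) ?_
  have : s ≤ √s ^ 2 := by
    rcases le_total 0 s with h0 | h0
    · rw [Real.sq_sqrt h0]
    · exact h0.trans (sq_nonneg _)
  nlinarith [Real.sqrt_nonneg s]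

/-- Jensen's inequality for the Bernoulli mean. -/
theorem bernoulliMean_jensen {ι : Type*} (hp0 : 0 ≤ p) (hp1 : p ≤ 1) {h : (ι → ℝ) → ℝ}
    (hh : ConvexOn ℝ Set.univ h) : ∀ {N : ℕ} (φ : (Fin N → ℝ) → ι → ℝ),
      h (fun j => bernoulliMean p N fun v => φ v j) ≤ bernoulliMean p N fun v => h (φ v)
  | 0, _ => le_rfl
  | N + 1, φ => by
      have h1 := bernoulliMean_jensen hp0 hp1 hh (fun v => φ (Fin.cons (1 - p) v))
      have h2 := bernoulliMean_jensen hp0 hp1 hh (fun v => φ (Fin.cons (-p) v))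
      have h3 := hh.2 (Set.mem_univ fun j => bernoulliMean p N fun v => φ (Fin.cons (1 - p) v) j)
        (Set.mem_univ fun j => bernoulliMean p N fun v => φ (Fin.cons (-p) v) j) hp0
        (sub_nonneg.2 hp1) (by ring)
      exact h3.trans (add_le_add (mul_le_mul_of_nonneg_left h1 hp0)
        (mul_le_mul_of_nonneg_left h2 (sub_nonneg.2 hp1)))

theorem integrable_bernoulliMean {α : Type*} [MeasurableSpace α] {μ : Measure α} :
    ∀ {N : ℕ} {F : α → (Fin N → ℝ) → ℝ} (_ : ∀ v, Integrable (fun z => F z v) μ),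
      Integrable (fun z => bernoulliMean p N (F z)) μ
  | 0, F, h => h _
  | N + 1, F, h => by
      simp only [bernoulliMean]
      exact ((integrable_bernoulliMean fun v => h _).const_mul _).add
        ((integrable_bernoulliMean fun v => h _).const_mul _)

theorem integral_bernoulliMean {α : Type*} [MeasurableSpace α] {μ : Measure α} :
    ∀ {N : ℕ} {F : α → (Fin N → ℝ) → ℝ} (_ : ∀ v, Integrable (fun z => F z v) μ),
      ∫ z, bernoulliMean p N (F z) ∂μ = bernoulliMean p N fun v => ∫ z, F z v ∂μ
  | 0, F, h => rfl
  | N + 1, F, h => by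
      simp only [bernoulliMean]
      rw [integral_add ((integrable_bernoulliMean fun v => h _).const_mul _)
        ((integrable_bernoulliMean fun v => h _).const_mul _), integral_const_mul,
        integral_const_mul, integral_bernoulliMean fun v => h _, integral_bernoulliMean fun v => h _]

/-- Contraction at a single centred two-valued weight. Note that `p` need not be `1 / 2`: this uses
that `ψ` is a nondecreasing function of `u`. -/
theorem two_point_contraction {𝓕 : Type*} [Nonempty 𝓕] (hp0 : 0 ≤ p) (hp1 : p ≤ 1)
    {A ψ u : 𝓕 → ℝ} (hψ : ∀ f g, ψ f - ψ g ≤ max 0 (u f - u g))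
    (h1 : BddAbove (Set.range fun f => A f + (1 - p) * u f))
    (h2 : BddAbove (Set.range fun f => A f + -p * u f)) :
    p * (⨆ f, (A f + (1 - p) * ψ f)) + (1 - p) * (⨆ f, (A f + -p * ψ f))
      ≤ p * (⨆ f, (A f + (1 - p) * u f)) + (1 - p) * (⨆ f, (A f + -p * u f)) := by
  have hq : 0 ≤ 1 - p := sub_nonneg.2 hp1
  set R := p * (⨆ f, (A f + (1 - p) * u f)) + (1 - p) * (⨆ f, (A f + -p * u f)) with hR
  have hmem : ∀ f g, p * (A f + (1 - p) * u f) + (1 - p) * (A g + -p * u g) ≤ R := fun f g =>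
    add_le_add (mul_le_mul_of_nonneg_left (le_ciSup h1 f) hp0)
      (mul_le_mul_of_nonneg_left (le_ciSup h2 g) hq)
  have key : ∀ f g, p * (A f + (1 - p) * ψ f) + (1 - p) * (A g + -p * ψ g) ≤ R := by
    intro f g
    have hpq : 0 ≤ p * (1 - p) := mul_nonneg hp0 hq
    have hm := mul_le_mul_of_nonneg_left (hψ f g) hpq
    -- The `ψ`-terms enter only as `p(1-p)(ψ f - ψ g)`. If `u f ≥ u g`, the same pair in `hmem`
    -- dominates. Otherwise this term is nonpositive, and the pairs `(f,f)` and `(g,g)` suffice,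
    -- since the centred weight cancels `u` there. Exchanging `f` and `g`, as for Rademacher signs,
    -- would not preserve the weights.
    rcases le_total 0 (u f - u g) with hu | hu
    · rw [max_eq_right hu] at hm
      have := hmem f g
      linarith
    · rw [max_eq_left hu] at hm
      have hf := mul_le_mul_of_nonneg_left (hmem f f) hp0
      have hg := mul_le_mul_of_nonneg_left (hmem g g) hq
      have e1 : p * (A f + (1 - p) * u f) + (1 - p) * (A f + -p * u f) = A f := by ring
      have e2 : p * (A g + (1 - p) * u g) + (1 - p) * (A g + -p * u g) = A g := by ring
      rw [e1] at hf
      rw [e2] at hg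
      linarith
  rw [Real.mul_iSup_of_nonneg hp0, Real.mul_iSup_of_nonneg hq]
  rw [← le_sub_iff_add_le]
  refine ciSup_le fun f => ?_
  rw [le_sub_comm]
  exact ciSup_le fun g => by linarith [key f g]

theorem bddAbove_range_of_abs_le {𝓕 : Type*} {A : 𝓕 → ℝ} {C : ℝ} (h : ∀ f, |A f| ≤ C) :
    BddAbove (Set.range A) :=
  ⟨C, by rintro _ ⟨f, rfl⟩; exact (le_abs_self _).trans (h f)⟩

theorem abs_add_sum_mul_le {N : ℕ} {a c C : ℝ} {b : Fin N → ℝ} (ha : |a| ≤ c)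
    (hb : ∀ i, |b i| ≤ C) (v : Fin N → ℝ) : |a + ∑ i, v i * b i| ≤ c + ∑ i, |v i| * C := by
  refine (abs_add_le _ _).trans (add_le_add ha ((Finset.abs_sum_le_sum_abs _ _).trans ?_))
  exact Finset.sum_le_sum fun i _ => by
    rw [abs_mul]; exact mul_le_mul_of_nonneg_left (hb i) (abs_nonneg _)

/-- The contraction principle for centred Bernoulli weights and nondecreasing contractions. -/
theorem bernoulliMean_contraction {𝓕 : Type*} [Nonempty 𝓕] (hp0 : 0 ≤ p) (hp1 : p ≤ 1) {C : ℝ} :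
    ∀ {N : ℕ} {A : 𝓕 → ℝ} {c : ℝ} (_ : ∀ f, |A f| ≤ c) {ψ u : Fin N → 𝓕 → ℝ}
      (_ : ∀ i f, |ψ i f| ≤ C) (_ : ∀ i f, |u i f| ≤ C)
      (_ : ∀ i f g, ψ i f - ψ i g ≤ max 0 (u i f - u i g)),
      bernoulliMean p N (fun v => ⨆ f, (A f + ∑ i, v i * ψ i f))
        ≤ bernoulliMean p N (fun v => ⨆ f, (A f + ∑ i, v i * u i f))
  | 0, A, c, hA, ψ, u, hψ, hu, h => le_of_eq (by simp [bernoulliMean])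
  | N + 1, A, c, hA, ψ, u, hψ, hu, h => by
      -- With the first weight frozen at `s`, the term `s * ψ 0` is absorbed into `A` and the other
      -- coordinates are contracted. The first coordinate is contracted last, pointwise in `v`.
      have hstep : ∀ s : ℝ, bernoulliMean p N
            (fun v => ⨆ f, (A f + (s * ψ 0 f + ∑ i : Fin N, v i * ψ i.succ f)))
          ≤ bernoulliMean p N
            (fun v => ⨆ f, ((A f + ∑ i : Fin N, v i * u i.succ f) + s * ψ 0 f)) := fun s => by
        have := bernoulliMean_contraction hp0 hp1 (N := N) (A := fun f => A f + s * ψ 0 f)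
          (c := c + |s| * C) (fun f => (abs_add_le _ _).trans (add_le_add (hA f) (by
            rw [abs_mul]; exact mul_le_mul_of_nonneg_left (hψ 0 f) (abs_nonneg _))))
          (fun i f => hψ i.succ f) (fun i f => hu i.succ f) fun i f g => h i.succ f g
        simp only [add_assoc] at this ⊢
        simpa only [add_comm (s * ψ 0 _)] using this
      have hbd : ∀ (s : ℝ) (v : Fin N → ℝ),
          BddAbove (Set.range fun f => (A f + ∑ i : Fin N, v i * u i.succ f) + s * u 0 f) := by
        intro s v
        refine bddAbove_range_of_abs_le (C := (c + ∑ i, |v i| * C) + |s| * C) fun f => ?_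
        refine (abs_add_le _ _).trans (add_le_add
          (abs_add_sum_mul_le (hA f) (fun i => hu i.succ f) v) ?_)
        rw [abs_mul]
        exact mul_le_mul_of_nonneg_left (hu 0 f) (abs_nonneg _)
      simp only [bernoulliMean, Fin.sum_univ_succ, Fin.cons_zero, Fin.cons_succ]
      refine (add_le_add (mul_le_mul_of_nonneg_left (hstep _) hp0)
        (mul_le_mul_of_nonneg_left (hstep _) (sub_nonneg.2 hp1))).trans ?_
      simp only [← bernoulliMean_const_mul, ← bernoulliMean_add]
      refine bernoulliMean_mono hp0 hp1 fun v _ => ?_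
      have := two_point_contraction hp0 hp1 (A := fun f => A f + ∑ i : Fin N, v i * u i.succ f)
        (h 0) (hbd _ v) (hbd _ v)
      simpa only [add_assoc, add_comm (∑ i : Fin N, v i * u i.succ _)] using this

/-- The mean width of a ball in Hilbert space, after contraction. -/
theorem bernoulliMean_iSup_le {E : Type*} [NormedAddCommGroup E] [InnerProductSpace ℝ E]
    (hp0 : 0 ≤ p) (hp1 : p ≤ 1) {Λ : ℝ} (hΛ : 0 ≤ Λ) {N : ℕ} {C : ℝ}
    {ψ : Fin N → Metric.closedBall (0 : E) Λ → ℝ} (hψC : ∀ i f, |ψ i f| ≤ C) (x : Fin N → E)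
    (hψ : ∀ i f g, ψ i f - ψ i g ≤ max 0 (inner ℝ (f : E) (x i) - inner ℝ (g : E) (x i))) :
    bernoulliMean p N (fun v => ⨆ f, ∑ i, v i * ψ i f)
      ≤ Λ * √(p * (1 - p) * ∑ i, ‖x i‖ ^ 2) := by
  have : Nonempty (Metric.closedBall (0 : E) Λ) := ⟨⟨0, by simpa using hΛ⟩⟩
  have hball : ∀ f : Metric.closedBall (0 : E) Λ, ‖(f : E)‖ ≤ Λ := fun f =>
    mem_closedBall_zero_iff.1 f.2
  have hx : ∀ i, ‖x i‖ ≤ ∑ j, ‖x j‖ := fun i =>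
    Finset.single_le_sum (f := fun j => ‖x j‖) (fun j _ => norm_nonneg _) (Finset.mem_univ i)
  have h := bernoulliMean_contraction hp0 hp1 (N := N) (A := fun _ => 0) (c := 0) (by simp)
    (C := max C (Λ * ∑ j, ‖x j‖)) (ψ := ψ)
    (u := fun i (f : Metric.closedBall (0 : E) Λ) => inner ℝ (f : E) (x i))
    (fun i f => (hψC i f).trans (le_max_left _ _))
    (fun i f => (((abs_real_inner_le_norm _ _).trans (mul_le_mul (hball f) (hx i)
      (norm_nonneg _) hΛ))).trans (le_max_right _ _)) hψ
  simp only [zero_add] at h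
  refine h.trans ?_
  have h2 : bernoulliMean p N (fun v => ⨆ f : Metric.closedBall (0 : E) Λ,
      ∑ i, v i * inner ℝ (f : E) (x i)) ≤ bernoulliMean p N (fun v => Λ * ‖∑ i, v i • x i‖) := by
    refine bernoulliMean_mono hp0 hp1 fun v _ => ciSup_le fun f => ?_
    have : ∑ i, v i * inner ℝ (f : E) (x i) = inner ℝ (f : E) (∑ i, v i • x i) := by
      simp [inner_sum, inner_smul_right]
    rw [this]
    exact (real_inner_le_norm _ _).trans (mul_le_mul_of_nonneg_right (hball f) (norm_nonneg _))
  rw [bernoulliMean_const_mul] at h2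
  refine h2.trans (mul_le_mul_of_nonneg_left (bernoulliMean_le_sqrt hp0 hp1 _ ?_) hΛ)
  have := bernoulliMean_norm_sq (p := p) (0 : E) x
  simp only [zero_add, norm_zero, ne_eq, OfNat.ofNat_ne_zero, not_false_eq_true, zero_pow] at this
  exact this.le

end BernoulliMean

/-! ### Sampling without replacement against Bernoulli sampling -/

/-- A symmetric convex function decreases when a vector is averaged over each of two blocks of
coordinates. -/
theorem ConvexOn.map_blockAverage_le {n m : ℕ} [NeZero n] [NeZero m]
    {h : (Fin n ⊕ Fin m → ℝ) → ℝ} (hh : ConvexOn ℝ Set.univ h)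
    (hsymm : ∀ (π : Equiv.Perm (Fin n ⊕ Fin m)) v, h (v ∘ π) = h v) (w : Fin n ⊕ Fin m → ℝ) :
    h (Sum.elim (fun _ => (∑ i, w (Sum.inl i)) / n) fun _ => (∑ j, w (Sum.inr j)) / m) ≤ h w := by
  have hn : (n : ℝ) ≠ 0 := Nat.cast_ne_zero.2 (NeZero.ne n)
  have hm : (m : ℝ) ≠ 0 := Nat.cast_ne_zero.2 (NeZero.ne m)
  -- Jensen over all pairs of cyclic shifts of the two blocks: every coordinate visits its whole
  -- block once per shift of the other block, and symmetry makes all values of `h` equal.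
  have hJ := hh.map_sum_le (t := (Finset.univ : Finset (Fin n × Fin m)))
    (w := fun _ => 1 / ((n : ℝ) * m))
    (p := fun st => w ∘ (Equiv.sumCongr (Equiv.addRight st.1) (Equiv.addRight st.2)))
    (fun _ _ => by positivity) (by simp; field_simp) (fun _ _ => Set.mem_univ _)
  simp only [hsymm] at hJ
  refine (le_of_eq ?_).trans (hJ.trans (le_of_eq ?_))
  · congr 1
    ext k
    rw [Finset.sum_apply, Fintype.sum_prod_type]
    rcases k with i | j
    · simp only [Sum.elim_inl, Pi.smul_apply, Function.comp_apply, Equiv.sumCongr_apply,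
        Sum.map_inl, Equiv.coe_addRight, smul_eq_mul, Finset.sum_const, Finset.card_univ,
        Fintype.card_fin, nsmul_eq_mul]
      rw [← Equiv.sum_comp (Equiv.addLeft i) fun s => w (Sum.inl s), Finset.sum_div]
      refine Finset.sum_congr rfl fun s _ => ?_
      simp only [Equiv.coe_addLeft]
      field_simp
    · simp only [Sum.elim_inr, Pi.smul_apply, Function.comp_apply, Equiv.sumCongr_apply,
        Sum.map_inr, Equiv.coe_addRight, smul_eq_mul, Finset.sum_const, Finset.card_univ,
        Fintype.card_fin, nsmul_eq_mul]
      rw [← Equiv.sum_comp (Equiv.addLeft j) fun s => w (Sum.inr s), Finset.sum_div,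
        Finset.mul_sum]
      refine Finset.sum_congr rfl fun s _ => ?_
      simp only [Equiv.coe_addLeft]
      field_simp
  · simp only [smul_eq_mul, Finset.sum_const, Finset.card_univ, Fintype.card_prod,
      Fintype.card_fin, nsmul_eq_mul, Nat.cast_mul]
    field_simp

/-- Two finite sets of the same cardinality are exchanged by a permutation. -/
theorem Finset.exists_perm_mem_iff {ι : Type*} [Fintype ι] [DecidableEq ι] {S T : Finset ι}
    (h : T.card = S.card) : ∃ π : Equiv.Perm ι, ∀ i, π i ∈ S ↔ i ∈ T := by
  let e : {x // x ∈ T} ≃ {x // x ∈ S} := Finset.equivOfCardEq h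
  refine ⟨e.extendSubtype, fun i => ⟨fun hi => ?_, fun hi => e.extendSubtype_mem i hi⟩⟩
  by_contra hT
  exact e.extendSubtype_not_mem i hT hi

/-- A two-valued vector dominates, for symmetric convex functions, a vector which is constant on
two given blocks and fills up the first block as far as possible. -/
theorem ConvexOn.map_block_le_of_two_valued {n m : ℕ} [NeZero n] [NeZero m]
    {h : (Fin n ⊕ Fin m → ℝ) → ℝ} (hh : ConvexOn ℝ Set.univ h)
    (hsymm : ∀ (π : Equiv.Perm (Fin n ⊕ Fin m)) v, h (v ∘ π) = h v) {p : ℝ}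
    (hp : p * (n + m) = n) {w : Fin n ⊕ Fin m → ℝ} (hw : ∀ i, w i = 1 - p ∨ w i = -p) :
    h (Sum.elim (fun _ => 1 - p - max (-∑ i, w i) 0 / n) fun _ => -p + max (∑ i, w i) 0 / m)
      ≤ h w := by
  classical
  have hn : (n : ℝ) ≠ 0 := Nat.cast_ne_zero.2 (NeZero.ne n)
  have hm : (m : ℝ) ≠ 0 := Nat.cast_ne_zero.2 (NeZero.ne m)
  let S : Finset (Fin n ⊕ Fin m) := Finset.univ.filter fun i => w i = 1 - p
  have hwS : ∀ i, w i = (if i ∈ S then 1 else 0) - p := fun i => by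
    by_cases hi : w i = 1 - p
    · simp [S, hi]
    · have hiS : i ∉ S := by simpa [S] using hi
      rw [if_neg hiS, zero_sub]
      exact (hw i).resolve_left hi
  have hsum : ∑ i, w i = (S.card : ℝ) - n := by
    simp only [hwS, Finset.sum_sub_distrib]
    simp
    linarith
  let B : Finset (Fin n ⊕ Fin m) := Finset.univ.map ⟨Sum.inl, Sum.inl_injective⟩
  have hB : B.card = n := by simp [B]
  have hle : S.card ≤ (Finset.univ : Finset (Fin n ⊕ Fin m)).card := Finset.card_le_univ S
  have main : ∀ T : Finset (Fin n ⊕ Fin m), T.card = S.card →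
      h (Sum.elim (fun _ => (∑ i : Fin n, ((if Sum.inl i ∈ T then 1 else 0) - p)) / n)
        fun _ => (∑ j : Fin m, ((if Sum.inr j ∈ T then 1 else 0) - p)) / m) ≤ h w := by
    intro T hT
    obtain ⟨π, hπ⟩ := Finset.exists_perm_mem_iff hT
    have h1 := hh.map_blockAverage_le hsymm (w ∘ π)
    rw [hsymm] at h1
    simpa only [Function.comp_apply, hwS, hπ] using h1
  have hBl : ∀ i : Fin n, Sum.inl i ∈ B := fun i => by simp [B]
  have hBr : ∀ j : Fin m, Sum.inr j ∉ B := fun j => by simp [B]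
  rw [hsum]
  -- A permutation moves the set `S` of high values inside the first block, or around it, according
  -- to cardinality; block averaging then gives the vector in the statement.
  rcases le_total S.card n with hK | hK
  · obtain ⟨T, hTB, hT⟩ := Finset.exists_subset_card_eq (hK.trans hB.ge)
    refine (le_of_eq ?_).trans (main T hT)
    have hr : ∀ j : Fin m, Sum.inr j ∉ T := fun j hj => hBr j (hTB hj)
    have hKr : (S.card : ℝ) ≤ n := Nat.cast_le.2 hK
    have hTs : ∑ i : Fin n, (if Sum.inl i ∈ T then (1 : ℝ) else 0) = S.card := by
      have : ∑ i : Fin n ⊕ Fin m, (if i ∈ T then (1 : ℝ) else 0) = S.card := by simp [hT]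
      rw [Fintype.sum_sum_type] at this
      simpa [hr] using this
    congr 2
    · ext i
      rw [max_eq_left (by linarith), Finset.sum_sub_distrib, hTs]
      simp
      field_simp
      ring
    · ext j
      rw [max_eq_right (by linarith)]
      simp [hr]
      field_simp
  · obtain ⟨T, hTB, -, hT⟩ := Finset.exists_subsuperset_card_eq (Finset.subset_univ B)
      (hB.le.trans hK) hle
    refine (le_of_eq ?_).trans (main T hT)
    have hl : ∀ i : Fin n, Sum.inl i ∈ T := fun i => hTB (hBl i)
    have hKr : (n : ℝ) ≤ S.card := Nat.cast_le.2 hK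
    have hTs : ∑ i : Fin m, (if Sum.inr i ∈ T then (1 : ℝ) else 0) = S.card - n := by
      have : ∑ i : Fin n ⊕ Fin m, (if i ∈ T then (1 : ℝ) else 0) = S.card := by simp [hT]
      rw [Fintype.sum_sum_type] at this
      simp [hl] at this
      simp
      linarith
    congr 2
    · ext i
      rw [max_eq_right (by linarith)]
      simp [hl]
      field_simp
    · ext j
      rw [max_eq_left (by linarith), Finset.sum_sub_distrib, hTs]
      simp
      field_simp
      ring

/-- Sampling without replacement is dominated by independent sampling: for a nonnegative symmetric
sublinear function, the weights that single out the first block of coordinates are dominated by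
independent centred Bernoulli weights. -/
theorem le_bernoulliMean_of_symmetric {n m : ℕ} [NeZero n] [NeZero m]
    {h : (Fin n ⊕ Fin m → ℝ) → ℝ} (hh : ConvexOn ℝ Set.univ h)
    (hsymm : ∀ (π : Equiv.Perm (Fin n ⊕ Fin m)) v, h (v ∘ π) = h v)
    (hhom : ∀ (a : ℝ) v, 0 ≤ a → h (a • v) = a * h v) (hnonneg : ∀ v, 0 ≤ h v) {p : ℝ}
    (hp : p * (n + m) = n) :
    (1 - √((n + m) * (p * (1 - p))) / (2 * (n * (1 - p)))) *
        h (Sum.elim (fun _ => 1 - p) fun _ => -p)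
      ≤ bernoulliMean p (n + m) fun v => h (v ∘ finSumFinEquiv) := by
  have hn : (0 : ℝ) < n := Nat.cast_pos.2 (NeZero.pos n)
  have hm : (0 : ℝ) < m := Nat.cast_pos.2 (NeZero.pos m)
  have hpv : p = n / (n + m) := by field_simp; exact hp
  have hp0 : 0 < p := by rw [hpv]; positivity
  have hq : 0 < 1 - p := by
    have : 1 - p = m / (n + m) := by rw [hpv]; field_simp; ring
    rw [this]; positivity
  have hp1 : p ≤ 1 := by linarith
  have hqm : (n : ℝ) * (1 - p) = p * m := by linarith
  -- The sum of the weights has mean zero, so its positive and negative parts have the same mean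
  -- `E`, half the mean absolute value; the variance bounds the latter.
  set E := bernoulliMean p (n + m) fun v => max (∑ i, v i) 0 with hE
  have hE' : (bernoulliMean p (n + m) fun v => max (-∑ i, v i) 0) = E := by
    have h1 := bernoulliMean_sum (p := p) (n + m)
    have h2 : (fun v : Fin (n + m) → ℝ => max (∑ i, v i) 0)
        = fun v => max (-∑ i, v i) 0 + ∑ i, v i := by
      ext v
      rcases le_total (∑ i, v i) 0 with hv | hv
      · rw [max_eq_right hv, max_eq_left (by linarith)]; ring
      · rw [max_eq_left hv, max_eq_right (by linarith)]; ring
    rw [hE, h2, bernoulliMean_add, h1, add_zero]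
  have hEle : E ≤ √((n + m) * (p * (1 - p))) / 2 := by
    have habs : bernoulliMean p (n + m) (fun v => |∑ i, v i|) ≤ √((n + m) * (p * (1 - p))) := by
      refine bernoulliMean_le_sqrt hp0.le hp1 _ (le_of_eq ?_)
      have := bernoulliMean_norm_sq (p := p) (0 : ℝ) (fun _ : Fin (n + m) => (1 : ℝ))
      simp at this
      simp only [sq_abs, this]
      ring
    have h2 : (fun v : Fin (n + m) → ℝ => |∑ i, v i|)
        = fun v => max (∑ i, v i) 0 + max (-∑ i, v i) 0 := by
      ext v
      rcases le_total (∑ i, v i) 0 with hv | hv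
      · rw [max_eq_right hv, max_eq_left (by linarith), abs_of_nonpos hv]; ring
      · rw [max_eq_left hv, max_eq_right (by linarith), abs_of_nonneg hv]; ring
    rw [h2, bernoulliMean_add, hE', ← hE] at habs
    linarith
  set a := 1 - E / (n * (1 - p)) with ha
  have hjensen : h (a • Sum.elim (fun _ => 1 - p) fun _ => -p)
      ≤ bernoulliMean p (n + m) fun v => h (v ∘ finSumFinEquiv) := by
    -- Averaging the block vectors over the random sum gives `1 - p - E/n` and `-p + E/m`. Since
    -- `n(1-p) = pm`, this is exactly `a` times the block weights.
    have h1 := bernoulliMean_jensen (N := n + m) hp0.le hp1 hh fun v =>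
      Sum.elim (fun _ => 1 - p - max (-∑ i, v i) 0 / n) fun _ => -p + max (∑ i, v i) 0 / m
    refine ((le_of_eq ?_).trans h1).trans (bernoulliMean_mono hp0.le hp1 fun v hv => ?_)
    · congr 1
      ext k
      rcases k with i | j
      · have : (fun v : Fin (n + m) → ℝ => 1 - p - max (-∑ i, v i) 0 / n)
            = fun v => (1 - p) + (-1 / (n : ℝ)) * max (-∑ i, v i) 0 := by ext v; ring
        simp only [Sum.elim_inl, Pi.smul_apply, smul_eq_mul]
        rw [this, bernoulliMean_add, bernoulliMean_const_mul, bernoulliMean_const, hE', ha]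
        field_simp
        ring
      · have : (fun v : Fin (n + m) → ℝ => -p + max (∑ i, v i) 0 / m)
            = fun v => -p + (1 / (m : ℝ)) * max (∑ i, v i) 0 := by ext v; ring
        simp only [Sum.elim_inr, Pi.smul_apply, smul_eq_mul]
        rw [this, bernoulliMean_add, bernoulliMean_const_mul, bernoulliMean_const, ← hE, ha, hqm]
        field_simp
        ring
    · have h2 := hh.map_block_le_of_two_valued hsymm hp (w := v ∘ finSumFinEquiv) fun i => hv _
      have h3 : ∑ i, (v ∘ finSumFinEquiv) i = ∑ i, v i := Equiv.sum_comp finSumFinEquiv v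
      rwa [h3] at h2
  set a₀ := 1 - √((n + m) * (p * (1 - p))) / (2 * (n * (1 - p))) with ha₀
  have haa : a₀ ≤ a := by
    have : E / (n * (1 - p)) ≤ √((n + m) * (p * (1 - p))) / (2 * (n * (1 - p))) := by
      rw [← div_div (√((n + m) * (p * (1 - p)))) 2]
      exact div_le_div_of_nonneg_right hEle (by positivity)
    linarith
  rcases le_total a₀ 0 with h0 | h0
  · refine (mul_nonpos_of_nonpos_of_nonneg h0 (hnonneg _)).trans ?_
    rw [← bernoulliMean_const (p := p) 0 (n + m)]
    exact bernoulliMean_mono hp0.le hp1 fun v _ => hnonneg _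
  · refine (mul_le_mul_of_nonneg_right haa (hnonneg _)).trans ?_
    rw [← hhom a _ (h0.trans haa)]
    exact hjensen

/-! ### Ghost samples: deviation and expected supremum -/

theorem abs_ciSup_le {𝓕 : Type*} [Nonempty 𝓕] {A : 𝓕 → ℝ} {C : ℝ} (h : ∀ f, |A f| ≤ C) :
    |⨆ f, A f| ≤ C := by
  obtain ⟨f₀⟩ := ‹Nonempty 𝓕›
  refine abs_le.2 ⟨?_, ciSup_le fun f => (le_abs_self _).trans (h f)⟩
  exact (neg_le_of_abs_le (h f₀)).trans (le_ciSup (bddAbove_range_of_abs_le h) f₀)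

theorem abs_sum_mul_le_sum_abs {ι : Type*} [Fintype ι] {a : ι → ℝ} (ha : ∀ i, |a i| ≤ 1)
    (v : ι → ℝ) : |∑ i, v i * a i| ≤ ∑ i, |v i| :=
  (Finset.abs_sum_le_sum_abs _ _).trans (Finset.sum_le_sum fun i _ => by
    rw [abs_mul]; exact mul_le_of_le_one_right (abs_nonneg _) (ha i))

theorem integral_sqrt_le {α : Type*} [MeasurableSpace α] {μ : Measure α} [IsProbabilityMeasure μ]
    {F : α → ℝ} (hF : Integrable F μ) (h0 : ∀ z, 0 ≤ F z) : ∫ z, √(F z) ∂μ ≤ √(∫ z, F z ∂μ) := by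
  have key : ∀ r : ℝ, 0 < r → ∫ z, F z ∂μ ≤ r ^ 2 → ∫ z, √(F z) ∂μ ≤ r := fun r hr hFr => by
    have hi : Integrable (fun z => r / 2 + 1 / (2 * r) * F z) μ :=
      (integrable_const _).add (hF.const_mul _)
    have h1 : ∫ z, √(F z) ∂μ ≤ ∫ z, (r / 2 + 1 / (2 * r) * F z) ∂μ := by
      refine integral_mono_of_nonneg (Filter.Eventually.of_forall fun z => Real.sqrt_nonneg _) hi
        (Filter.Eventually.of_forall fun z => ?_)
      have h2 : r / 2 + 1 / (2 * r) * F z - √(F z) = (√(F z) - r) ^ 2 / (2 * r) := by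
        have := Real.sq_sqrt (h0 z)
        field_simp
        nlinarith
      have h3 : 0 ≤ (√(F z) - r) ^ 2 / (2 * r) := by positivity
      simp only
      linarith
    rw [integral_add (integrable_const _) (hF.const_mul _), integral_const_mul] at h1
    simp only [integral_const, probReal_univ, one_smul] at h1
    have h4 := mul_le_mul_of_nonneg_left hFr (by positivity : (0 : ℝ) ≤ 1 / (2 * r))
    have h5 : 1 / (2 * r) * r ^ 2 = r / 2 := by field_simp
    linarith
  refine le_of_forall_pos_le_add fun ε hε => key _ (by positivity) ?_
  have := Real.sq_sqrt (integral_nonneg (μ := μ) h0)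
  nlinarith [Real.sqrt_nonneg (∫ z, F z ∂μ)]

theorem MeasureTheory.MeasurePreserving.integral_comp_of_measurable {α β : Type*}
    [MeasurableSpace α] [MeasurableSpace β] {μ : Measure α} {ν : Measure β} {φ : α → β}
    (h : MeasurePreserving φ μ ν) {g : β → ℝ} (hg : Measurable g) :
    ∫ x, g (φ x) ∂μ = ∫ y, g y ∂ν := by
  rw [← h.map_eq, integral_map h.measurable.aemeasurable hg.aestronglyMeasurable]

theorem integral_pi_eval {ι 𝒵 : Type*} [Fintype ι] [MeasurableSpace 𝒵] (P : Measure 𝒵)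
    [IsProbabilityMeasure P] {g : 𝒵 → ℝ} (hg : Measurable g) (i : ι) :
    ∫ z, g (z i) ∂(Measure.pi fun _ : ι => P) = ∫ x, g x ∂P :=
  (measurePreserving_eval (fun _ : ι => P) i).integral_comp_of_measurable hg

theorem integrable_pi_eval {ι 𝒵 : Type*} [Fintype ι] [MeasurableSpace 𝒵] {P : Measure 𝒵}
    [IsProbabilityMeasure P] {g : 𝒵 → ℝ} (hg : Integrable g P) (i : ι) :
    Integrable (fun z => g (z i)) (Measure.pi fun _ : ι => P) :=
  (measurePreserving_eval (fun _ : ι => P) i).integrable_comp_of_integrable hg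

/-- The weights that compare the average over a sample of size `n` with the average over a ghost
sample of size `m`. -/
noncomputable def ghostWeight (n m : ℕ) : Fin n ⊕ Fin m → ℝ :=
  Sum.elim (fun _ => (n : ℝ)⁻¹) fun _ => -(m : ℝ)⁻¹

theorem sum_ghostWeight_mul {n m : ℕ} (b : Fin n ⊕ Fin m → ℝ) :
    ∑ i, ghostWeight n m i * b i
      = (∑ i, b (Sum.inl i)) / n - (∑ j, b (Sum.inr j)) / m := by
  rw [Fintype.sum_sum_type]
  simp only [ghostWeight, Sum.elim_inl, Sum.elim_inr, ← Finset.mul_sum]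
  ring

theorem sum_ghostWeight_sq {n m : ℕ} [NeZero n] [NeZero m] :
    ∑ i, ghostWeight n m i ^ 2 = (n : ℝ)⁻¹ + (m : ℝ)⁻¹ := by
  have hn : (n : ℝ) ≠ 0 := Nat.cast_ne_zero.2 (NeZero.ne n)
  have hm : (m : ℝ) ≠ 0 := Nat.cast_ne_zero.2 (NeZero.ne m)
  rw [Fintype.sum_sum_type]
  simp [ghostWeight]
  field_simp

section GhostSample

variable {𝓕 𝒵 : Type*} [Nonempty 𝓕] [MeasurableSpace 𝒵] (P : Measure 𝒵) [IsProbabilityMeasure P]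
  {n m : ℕ} [NeZero n] [NeZero m]

/-- A uniform one-sided deviation inequality, in terms of the expected supremum of the difference
of the averages over the sample and over a ghost sample. -/
theorem exists_measure_le_forall_average_sub_integral_lt {g : 𝓕 → 𝒵 → ℝ}
    (hg : ∀ f, Measurable (g f)) (hg0 : ∀ f z, 0 ≤ g f z) (hg1 : ∀ f z, g f z ≤ 1)
    (hsup : Measurable fun z : Fin n ⊕ Fin m → 𝒵 => ⨆ f, ∑ i, ghostWeight n m i * g f (z i))
    {M t : ℝ} (hM : ∫ z, (⨆ f, ∑ i, ghostWeight n m i * g f (z i))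
      ∂(Measure.pi fun _ : Fin n ⊕ Fin m => P) ≤ M) (ht : M < t) :
    ∃ B : Set (Fin n → 𝒵), MeasurableSet B ∧
      (Measure.pi fun _ => P).real B
        ≤ Real.exp (-(2 * (t - M) ^ 2 / ((n : ℝ)⁻¹ + (m : ℝ)⁻¹))) ∧
      ∀ z, z ∉ B → ∀ f, (∑ i, g f (z i)) / n - ∫ x, g f x ∂P < t := by
  have hn : (0 : ℝ) < n := Nat.cast_pos.2 (NeZero.pos n)
  have hm : (0 : ℝ) < m := Nat.cast_pos.2 (NeZero.pos m)
  set Ψ : (Fin n ⊕ Fin m → 𝒵) → ℝ := fun z => ⨆ f, ∑ i, ghostWeight n m i * g f (z i) with hΨ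
  have habs : ∀ f z, |g f z| ≤ 1 := fun f z => by rw [abs_of_nonneg (hg0 f z)]; exact hg1 f z
  have hΨC : ∀ z, |Ψ z| ≤ ∑ i, |ghostWeight n m i| := fun z =>
    abs_ciSup_le fun f => abs_sum_mul_le_sum_abs (fun i => habs f (z i)) _
  have hbdd : ∀ z : Fin n ⊕ Fin m → 𝒵,
      BddAbove (Set.range fun f => ∑ i, ghostWeight n m i * g f (z i)) := fun z =>
    bddAbove_range_of_abs_le fun f => abs_sum_mul_le_sum_abs (fun i => habs f (z i)) _
  set c : ℝ := (n : ℝ)⁻¹ + (m : ℝ)⁻¹ with hc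
  have hc0 : 0 < c := by positivity
  -- Minimizer of the Chernoff exponent `l(M - t) + l²c/8`.
  set l : ℝ := 4 * (t - M) / c with hl
  have hl0 : 0 < l := div_pos (by linarith) hc0
  have hmcd := integral_exp_le_of_bounded_differences P hsup hΨC
    (c := fun i => |ghostWeight n m i|) (fun i z x => by
      rw [sub_le_iff_le_add]
      refine ciSup_le fun f => ?_
      refine le_trans ?_ (add_le_add_right (le_ciSup (hbdd z) f) _)
      rw [← sub_le_iff_le_add, ← Finset.sum_sub_distrib, Finset.sum_eq_single i]
      · rw [Function.update_self, ← mul_sub]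
        refine (le_abs_self _).trans ?_
        rw [abs_mul]
        refine mul_le_of_le_one_right (abs_nonneg _) (abs_le.2 ⟨?_, ?_⟩) <;>
          linarith [hg0 f x, hg1 f x, hg0 f (z i), hg1 f (z i)]
      · intro j _ hj
        rw [Function.update_of_ne hj, sub_self]
      · simp) l
  simp only [sq_abs, sum_ghostWeight_sq, ← hc] at hmcd
  have hmp := measurePreserving_sumPiEquivProdPi_symm (fun _ : Fin n ⊕ Fin m => P)
  have happ : ∀ q : (Fin n → 𝒵) × (Fin m → 𝒵),
      (MeasurableEquiv.sumPiEquivProdPi fun _ : Fin n ⊕ Fin m => 𝒵).symm q = Sum.elim q.1 q.2 := by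
    intro q
    ext k
    rcases k with i | j <;> rfl
  have hΨm : Measurable fun q : (Fin n → 𝒵) × (Fin m → 𝒵) => Ψ (Sum.elim q.1 q.2) := by
    have := hsup.comp hmp.measurable
    simpa only [Function.comp_def, happ] using this
  have hEi : Integrable (fun q : (Fin n → 𝒵) × (Fin m → 𝒵) => Real.exp (l * Ψ (Sum.elim q.1 q.2)))
      ((Measure.pi fun _ => P).prod (Measure.pi fun _ => P)) :=
    integrable_exp_mul_of_forall_abs_le hΨm (fun q => hΨC _) l
  have hsplit : ∫ z, Real.exp (l * Ψ z) ∂(Measure.pi fun _ : Fin n ⊕ Fin m => P)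
      = ∫ z : Fin n → 𝒵, ∫ z' : Fin m → 𝒵, Real.exp (l * Ψ (Sum.elim z z'))
          ∂(Measure.pi fun _ => P) ∂(Measure.pi fun _ => P) := by
    rw [← integral_prod _ hEi, ← hmp.integral_comp']
    simp only [happ]
  -- The ghost sample is integrated out after exponentiation. The bad event `W ≥ exp(lt)` is then a
  -- measurable condition on the sample alone, with no supremum over `f` of true expectations.
  set W : (Fin n → 𝒵) → ℝ := fun z =>
    ∫ z' : Fin m → 𝒵, Real.exp (l * Ψ (Sum.elim z z')) ∂(Measure.pi fun _ => P) with hW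
  have hWm : Measurable W := by
    have h1 : StronglyMeasurable (Function.uncurry fun (z : Fin n → 𝒵) (z' : Fin m → 𝒵) =>
        Real.exp (l * Ψ (Sum.elim z z'))) :=
      (Real.measurable_exp.comp (hΨm.const_mul l)).stronglyMeasurable
    exact h1.integral_prod_right.measurable
  have hW0 : ∀ z, 0 ≤ W z := fun z => integral_nonneg fun z' => (Real.exp_pos _).le
  refine ⟨{z | Real.exp (l * t) ≤ W z}, measurableSet_le measurable_const hWm, ?_, ?_⟩
  · have hmk := mul_meas_ge_le_integral_of_nonneg (Filter.Eventually.of_forall hW0)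
      hEi.integral_prod_left (Real.exp (l * t))
    rw [← hsplit] at hmk
    have h1 := hmk.trans hmcd
    have h2 : l * ∫ z, Ψ z ∂(Measure.pi fun _ : Fin n ⊕ Fin m => P) ≤ l * M :=
      mul_le_mul_of_nonneg_left hM hl0.le
    have h3 : Real.exp (l * t) * (Measure.pi fun _ : Fin n => P).real {z | Real.exp (l * t) ≤ W z}
        ≤ Real.exp (l * M + l ^ 2 * c / 8) :=
      h1.trans (Real.exp_le_exp.2 (by linarith))
    rw [← le_div_iff₀' (Real.exp_pos _), ← Real.exp_sub] at h3
    refine h3.trans (le_of_eq ?_)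
    congr 1
    rw [hl]
    field_simp
    ring
  · intro z hz f
    have hz' : W z < Real.exp (l * t) := not_le.1 hz
    set d : (Fin m → 𝒵) → ℝ := fun z' =>
      l * ((∑ i, g f (z i)) / n - (∑ j, g f (z' j)) / m) with hd
    have hgi : Integrable (g f) P := integrable_of_forall_abs_le (hg f) (habs f)
    have hdm : Measurable d := by
      have : Measurable fun z' : Fin m → 𝒵 => ∑ j, g f (z' j) :=
        Finset.measurable_sum _ fun j _ => (hg f).comp (measurable_pi_apply j)
      fun_prop
    have hdle : ∀ z', d z' ≤ l * Ψ (Sum.elim z z') := fun z' => by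
      refine mul_le_mul_of_nonneg_left ?_ hl0.le
      have := le_ciSup (hbdd (Sum.elim z z')) f
      rw [sum_ghostWeight_mul] at this
      exact this
    have hdi : Integrable d (Measure.pi fun _ => P) := by
      refine ((integrable_const _).sub ?_).const_mul _
      exact (integrable_finsetSum _ fun j _ => integrable_pi_eval hgi j).div_const _
    have hdint : ∫ z', d z' ∂(Measure.pi fun _ : Fin m => P)
        = l * ((∑ i, g f (z i)) / n - ∫ x, g f x ∂P) := by
      have h1 : ∫ z' : Fin m → 𝒵, (∑ j, g f (z' j)) / m ∂(Measure.pi fun _ => P)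
          = ∫ x, g f x ∂P := by
        rw [integral_div, integral_finsetSum _ fun j _ => integrable_pi_eval hgi j]
        simp only [integral_pi_eval P (hg f)]
        simp
        field_simp
      rw [hd, integral_const_mul, integral_sub (integrable_const _)
        ((integrable_finsetSum _ fun j _ => integrable_pi_eval hgi j).div_const _), h1]
      simp
    have hEsec : Integrable (fun z' => Real.exp (l * Ψ (Sum.elim z z')))
        (Measure.pi fun _ : Fin m => P) :=
      integrable_exp_mul_of_forall_abs_le (hΨm.comp measurable_prodMk_left) (fun q => hΨC _) l
    have hexpd : Integrable (fun z' => Real.exp (d z')) (Measure.pi fun _ : Fin m => P) :=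
      hEsec.mono' (Real.measurable_exp.comp hdm).aestronglyMeasurable
        (Filter.Eventually.of_forall fun z' => by
          rw [Real.norm_eq_abs, abs_of_pos (Real.exp_pos _)]
          exact Real.exp_le_exp.2 (hdle z'))
    -- Jensen in the ghost sample, for each fixed `f`, turns the ghost average into the true
    -- expectation.
    have hJ := convexOn_exp.map_integral_le Real.continuous_exp.continuousOn isClosed_univ
      (Filter.Eventually.of_forall fun _ => Set.mem_univ _) hdi hexpd
    have hfin := (hJ.trans (integral_mono hexpd hEsec fun z' =>
      Real.exp_le_exp.2 (hdle z'))).trans_lt hz'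
    rw [hdint, Real.exp_lt_exp] at hfin
    exact lt_of_mul_lt_mul_left hfin hl0.le

variable {E : Type*} [NormedAddCommGroup E] [InnerProductSpace ℝ E]

/-- The expected supremum, over a ball of radius `Λ` in Hilbert space, of the difference of the
averages over the sample and over a ghost sample. -/
theorem integral_iSup_ghostWeight_le {Λ : ℝ} (hΛ : 0 ≤ Λ)
    {a : Metric.closedBall (0 : E) Λ → 𝒵 → ℝ} (ha1 : ∀ f z, |a f z| ≤ 1)
    (ha0 : ∃ f, ∀ z, a f z = 0) (x : 𝒵 → E)
    (ha : ∀ f g z, a f z - a g z ≤ max 0 (inner ℝ (f : E) (x z) - inner ℝ (g : E) (x z)))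
    (hsup : ∀ v : Fin n ⊕ Fin m → ℝ,
      Measurable fun z : Fin n ⊕ Fin m → 𝒵 => ⨆ f, ∑ i, v i * a f (z i))
    {τ : 𝒵 → ℝ} (hτ : Integrable τ P) (hτm : Measurable τ) (hxτ : ∀ z, ‖x z‖ ^ 2 ≤ τ z) :
    (1 - √((n : ℝ)⁻¹ + (m : ℝ)⁻¹) / 2) *
        ∫ z, (⨆ f, ∑ i, ghostWeight n m i * a f (z i)) ∂(Measure.pi fun _ : Fin n ⊕ Fin m => P)
      ≤ Λ * √(((n : ℝ)⁻¹ + (m : ℝ)⁻¹) * ∫ z, τ z ∂P) := by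
  have hn : (0 : ℝ) < n := Nat.cast_pos.2 (NeZero.pos n)
  have hm : (0 : ℝ) < m := Nat.cast_pos.2 (NeZero.pos m)
  obtain ⟨f₀, hf₀⟩ := ha0
  have : Nonempty (Metric.closedBall (0 : E) Λ) := ⟨f₀⟩
  set Φ : (Fin n ⊕ Fin m → ℝ) → (Fin n ⊕ Fin m → 𝒵) → ℝ := fun v z => ⨆ f, ∑ i, v i * a f (z i)
    with hΦ
  have hbdd : ∀ (v : Fin n ⊕ Fin m → ℝ) (z : Fin n ⊕ Fin m → 𝒵),
      BddAbove (Set.range fun f => ∑ i, v i * a f (z i)) := fun v z =>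
    bddAbove_range_of_abs_le fun f => abs_sum_mul_le_sum_abs (fun i => ha1 f (z i)) _
  have hΦi : ∀ v, Integrable (Φ v) (Measure.pi fun _ => P) := fun v =>
    integrable_of_forall_abs_le (hsup v) fun z =>
      abs_ciSup_le fun f => abs_sum_mul_le_sum_abs (fun i => ha1 f (z i)) _
  have hΦ0 : ∀ v z, 0 ≤ Φ v z := fun v z => by
    have := le_ciSup (hbdd v z) f₀
    simpa only [hf₀, mul_zero, Finset.sum_const_zero] using this
  have hΦhom : ∀ (r : ℝ) v z, 0 ≤ r → Φ (r • v) z = r * Φ v z := fun r v z hr => by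
    simp only [hΦ, Pi.smul_apply, smul_eq_mul, Real.mul_iSup_of_nonneg hr, Finset.mul_sum, mul_assoc]
  have hΦadd : ∀ v w z, Φ (v + w) z ≤ Φ v z + Φ w z := fun v w z => by
    refine ciSup_le fun f => ?_
    simp only [Pi.add_apply, add_mul, Finset.sum_add_distrib]
    exact add_le_add (le_ciSup (hbdd v z) f) (le_ciSup (hbdd w z) f)
  -- As a function of the weights, the expected supremum is sublinear, and it is symmetric because
  -- the pooled sample is exchangeable.
  set h : (Fin n ⊕ Fin m → ℝ) → ℝ := fun v => ∫ z, Φ v z ∂(Measure.pi fun _ => P) with hh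
  have hhom : ∀ (r : ℝ) v, 0 ≤ r → h (r • v) = r * h v := fun r v hr => by
    simp only [hh, hΦhom r v _ hr, integral_const_mul]
  have hconv : ConvexOn ℝ Set.univ h := by
    refine ⟨convex_univ, fun v _ w _ r s hr hs _ => ?_⟩
    rw [smul_eq_mul, smul_eq_mul, ← hhom r v hr, ← hhom s w hs]
    simp only [hh]
    rw [← integral_add (hΦi _) (hΦi _)]
    exact integral_mono (hΦi _) ((hΦi _).add (hΦi _)) fun z => hΦadd _ _ z
  have hsymm : ∀ (π : Equiv.Perm (Fin n ⊕ Fin m)) v, h (v ∘ π) = h v := fun π v => by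
    have hmp := measurePreserving_comp_equiv (𝒵 := 𝒵) P π
    have h1 : ∀ z, Φ v z = Φ (v ∘ π) (z ∘ π) := fun z => by
      simp only [hΦ]
      congr 1
      ext f
      exact (Equiv.sum_comp π fun i => v i * a f (z i)).symm
    have h2 := hmp.integral_comp_of_measurable (hsup (v ∘ π))
    exact h2.symm.trans (integral_congr_ae (Filter.Eventually.of_forall fun z => (h1 z).symm))
  set p : ℝ := n / (n + m) with hp
  have hp0 : 0 ≤ p := by positivity
  have hq : 1 - p = m / (n + m) := by rw [hp]; field_simp; ring
  have hp1 : p ≤ 1 := by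
    have : 0 ≤ 1 - p := by rw [hq]; positivity
    linarith
  set c : ℝ := (n : ℝ)⁻¹ + (m : ℝ)⁻¹ with hc
  have hc0 : 0 < c := by positivity
  have hcinv : c⁻¹ = n * m / (n + m) := by rw [hc]; field_simp; ring
  have hmain := le_bernoulliMean_of_symmetric hconv hsymm hhom
    (fun v => integral_nonneg fun z => hΦ0 v z) (p := p) (by rw [hp]; field_simp)
  have hα : √((n + m) * (p * (1 - p))) / (2 * (n * (1 - p))) = √c / 2 := by
    have h1 : (n + m) * (p * (1 - p)) = c⁻¹ := by rw [hcinv, hq, hp]; field_simp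
    have h2 : n * (1 - p) = c⁻¹ := by rw [hcinv, hq]; field_simp
    rw [h1, h2, Real.sqrt_inv]
    have := Real.sq_sqrt hc0.le
    have h3 : 0 < √c := Real.sqrt_pos.2 hc0
    field_simp
    exact this.symm
  rw [hα] at hmain
  have hw : ghostWeight n m = c • Sum.elim (fun _ => 1 - p) fun _ => -p := by
    ext k
    rcases k with i | j
    · simp only [ghostWeight, Sum.elim_inl, Pi.smul_apply, smul_eq_mul, hq, hc]; field_simp; ring
    · simp only [ghostWeight, Sum.elim_inr, Pi.smul_apply, smul_eq_mul, hp, hc]; field_simp; ring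
  have hgoal : ∫ z, (⨆ f, ∑ i, ghostWeight n m i * a f (z i))
      ∂(Measure.pi fun _ : Fin n ⊕ Fin m => P)
        = c * h (Sum.elim (fun _ => 1 - p) fun _ => -p) := by
    rw [← hhom _ _ hc0.le, ← hw]
  rw [hgoal]
  -- The two averages are exchanged, so that the ball width estimate applies at each fixed pooled
  -- sample.
  have hmean : bernoulliMean p (n + m) (fun v => h (v ∘ finSumFinEquiv))
      ≤ Λ * √(c⁻¹ * ∫ z, τ z ∂P) := by
    have hsum : Integrable (fun z : Fin n ⊕ Fin m → 𝒵 => ∑ i, τ (z i)) (Measure.pi fun _ => P) :=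
      integrable_finsetSum _ fun i _ => integrable_pi_eval hτ i
    have hτ0 : ∀ z, 0 ≤ τ z := fun z => (sq_nonneg _).trans (hxτ z)
    have hF0 : ∀ z : Fin n ⊕ Fin m → 𝒵, 0 ≤ p * (1 - p) * ∑ i, τ (z i) := fun z =>
      mul_nonneg (mul_nonneg hp0 (by linarith)) (Finset.sum_nonneg fun i _ => hτ0 _)
    have hFi := hsum.const_mul (p * (1 - p))
    have hsqrt := integral_sqrt_le hFi hF0
    have hval : ∫ z : Fin n ⊕ Fin m → 𝒵, p * (1 - p) * ∑ i, τ (z i) ∂(Measure.pi fun _ => P)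
        = c⁻¹ * ∫ z, τ z ∂P := by
      rw [integral_const_mul, integral_finsetSum _ fun i _ => integrable_pi_eval hτ i]
      simp only [integral_pi_eval P hτm]
      rw [hcinv, hq, hp]
      simp
      field_simp
    rw [hval] at hsqrt
    rw [← integral_bernoulliMean fun v => hΦi _]
    refine le_trans ?_ (mul_le_mul_of_nonneg_left hsqrt hΛ)
    rw [← integral_const_mul]
    have hsqi : Integrable (fun z : Fin n ⊕ Fin m → 𝒵 => √(p * (1 - p) * ∑ i, τ (z i)))
        (Measure.pi fun _ => P) := by
      refine ((integrable_const (1 : ℝ)).add hFi).mono'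
        (Real.continuous_sqrt.measurable.comp_aemeasurable hFi.aemeasurable).aestronglyMeasurable
        (Filter.Eventually.of_forall fun z => ?_)
      rw [Real.norm_eq_abs, abs_of_nonneg (Real.sqrt_nonneg _)]
      have := Real.sq_sqrt (hF0 z)
      simp only [Pi.add_apply]
      nlinarith [sq_nonneg (√(p * (1 - p) * ∑ i, τ (z i)) - 1)]
    refine integral_mono (integrable_bernoulliMean fun v => hΦi _) (hsqi.const_mul Λ) fun z => ?_
    have hb := bernoulliMean_iSup_le hp0 hp1 hΛ (N := n + m) (C := 1)
      (ψ := fun i f => a f (z (finSumFinEquiv.symm i))) (fun i f => ha1 f _)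
      (fun i => x (z (finSumFinEquiv.symm i))) fun i f g => ha f g _
    have hreix : (fun v : Fin (n + m) → ℝ => Φ (v ∘ finSumFinEquiv) z)
        = fun v => ⨆ f, ∑ i, v i * a f (z (finSumFinEquiv.symm i)) := by
      ext v
      simp only [hΦ]
      congr 1
      ext f
      rw [← Equiv.sum_comp finSumFinEquiv]
      simp
    change bernoulliMean p (n + m) (fun v => Φ (v ∘ finSumFinEquiv) z) ≤ _
    rw [hreix]
    refine hb.trans (mul_le_mul_of_nonneg_left (Real.sqrt_le_sqrt ?_) hΛ)
    refine mul_le_mul_of_nonneg_left ?_ (mul_nonneg hp0 (by linarith))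
    rw [Equiv.sum_comp finSumFinEquiv.symm fun i => ‖x (z i)‖ ^ 2]
    exact Finset.sum_le_sum fun i _ => hxτ _
  calc (1 - √c / 2) * (c * h (Sum.elim (fun _ => 1 - p) fun _ => -p))
      = c * ((1 - √c / 2) * h (Sum.elim (fun _ => 1 - p) fun _ => -p)) := by ring
    _ ≤ c * (Λ * √(c⁻¹ * ∫ z, τ z ∂P)) := mul_le_mul_of_nonneg_left (hmain.trans hmean) hc0.le
    _ = Λ * √(c * ∫ z, τ z ∂P) := by
        rw [Real.sqrt_mul (by positivity), Real.sqrt_mul hc0.le, Real.sqrt_inv]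
        have := Real.sq_sqrt hc0.le
        have h3 : 0 < √c := Real.sqrt_pos.2 hc0
        field_simp
        rw [this]
        ring

end GhostSample

/-! ### Quantile truncation and a lower tail -/

/-- The infimum of the points where the distribution function reaches `b` works: the left limit
there is at most `b`, and right continuity gives the other inequality. -/
theorem exists_quantile (ν : Measure ℝ) [IsProbabilityMeasure ν] {b : ℝ} (hb0 : 0 < b)
    (hb1 : b < 1) : ∃ θ, ν.real (Set.Iio θ) ≤ b ∧ b ≤ ν.real (Set.Iic θ) := by
  set S : Set ℝ := {t | b ≤ cdf ν t} with hS
  have hne : S.Nonempty :=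
    ((tendsto_cdf_atTop ν).eventually_const_le hb1).exists
  have hbdd : BddBelow S := by
    obtain ⟨t₀, ht₀⟩ := ((tendsto_cdf_atBot ν).eventually_lt_const hb0).exists
    refine ⟨t₀, fun t ht => ?_⟩
    by_contra hlt
    exact absurd (ht.trans (monotone_cdf ν (not_le.1 hlt).le)) (not_le.2 ht₀)
  refine ⟨sInf S, ?_, ?_⟩
  · have h1 : ν (Set.Iio (sInf S)) = ENNReal.ofReal (Function.leftLim (cdf ν) (sInf S)) := by
      conv_lhs => rw [← measure_cdf ν]
      rw [StieltjesFunction.measure_Iio _ (tendsto_cdf_atBot ν), sub_zero]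
    rw [Measure.real, h1]
    refine ENNReal.toReal_le_of_le_ofReal hb0.le (ENNReal.ofReal_le_ofReal ?_)
    refine le_of_tendsto ((monotone_cdf ν).tendsto_leftLim _) ?_
    filter_upwards [self_mem_nhdsWithin] with t ht
    exact (not_le.1 fun h => absurd (csInf_le hbdd h) (not_le.2 ht)).le
  · rw [← cdf_eq_real]
    have hrc : Filter.Tendsto (cdf ν) (nhdsWithin (sInf S) (Set.Ioi (sInf S)))
        (nhds (cdf ν (sInf S))) :=
      ((cdf ν).right_continuous _).tendsto.mono_left (nhdsWithin_mono _ Set.Ioi_subset_Ici_self)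
    refine ge_of_tendsto hrc ?_
    filter_upwards [self_mem_nhdsWithin] with t ht
    obtain ⟨s, hs, hst⟩ := exists_lt_of_csInf_lt hne ht
    exact le_trans hs (monotone_cdf ν hst.le)

/-- A nonnegative function `τ` can be truncated by a weight which removes exactly the mass `a` of
its largest values. -/
theorem exists_truncation {𝒵 : Type*} [MeasurableSpace 𝒵] (P : Measure 𝒵) [IsProbabilityMeasure P]
    {τ : 𝒵 → ℝ} (hτ : Measurable τ) (hτ0 : ∀ z, 0 ≤ τ z) {a : ℝ} (ha0 : 0 < a) (ha1 : a < 1) :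
    ∃ (θ : ℝ) (w : 𝒵 → ℝ), 0 ≤ θ ∧ Measurable w ∧ (∀ z, 0 ≤ w z) ∧ (∀ z, w z ≤ 1) ∧
      ∫ z, (1 - w z) ∂P = a ∧ ∀ z, w z * τ z = min (τ z) θ - (1 - w z) * θ := by
  have : IsProbabilityMeasure (P.map τ) := Measure.isProbabilityMeasure_map hτ.aemeasurable
  obtain ⟨θ, h1, h2⟩ := exists_quantile (P.map τ) (b := 1 - a) (by linarith) (by linarith)
  rw [map_measureReal_apply hτ measurableSet_Iio] at h1
  rw [map_measureReal_apply hτ measurableSet_Iic] at h2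
  have hLt : MeasurableSet (τ ⁻¹' Set.Iio θ) := hτ measurableSet_Iio
  have hEq : MeasurableSet (τ ⁻¹' {θ}) := hτ (measurableSet_singleton θ)
  have hLe : P.real (τ ⁻¹' Set.Iic θ) = P.real (τ ⁻¹' Set.Iio θ) + P.real (τ ⁻¹' {θ}) := by
    have hdisj : Disjoint (τ ⁻¹' Set.Iio θ) (τ ⁻¹' {θ}) :=
      Set.disjoint_left.2 fun z hz hz' => absurd hz' (ne_of_lt hz)
    rw [← measureReal_union hdisj hEq, ← Set.preimage_union]
    congr 2
    ext t
    simp [le_iff_lt_or_eq, or_comm]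
  have hθ : 0 ≤ θ := by
    by_contra hneg
    have : τ ⁻¹' Set.Iic θ = ∅ := by
      ext z
      simp only [Set.mem_preimage, Set.mem_Iic, Set.mem_empty_iff_false, iff_false, not_le]
      exact (not_le.1 hneg).trans_le (hτ0 z)
    rw [this] at h2
    simp at h2
    linarith
  rw [hLe] at h2
  -- The fraction of the atom at `θ` to keep. Without an atom, `h1` and `h2` force the numerator to
  -- vanish, so the value `0/0 = 0` is harmless.
  set w₀ : ℝ := (1 - a - P.real (τ ⁻¹' Set.Iio θ)) / P.real (τ ⁻¹' {θ}) with hw₀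
  have hE0 : 0 ≤ P.real (τ ⁻¹' {θ}) := measureReal_nonneg
  have hw₀0 : 0 ≤ w₀ := div_nonneg (by linarith) hE0
  have hw₀1 : w₀ ≤ 1 := div_le_one_of_le₀ (by linarith) hE0
  have hw₀E : w₀ * P.real (τ ⁻¹' {θ}) = 1 - a - P.real (τ ⁻¹' Set.Iio θ) := by
    rcases hE0.eq_or_lt with h | h
    · rw [← h] at h2 ⊢
      linarith
    · rw [hw₀]; field_simp
  set w : 𝒵 → ℝ := fun z => (τ ⁻¹' Set.Iio θ).indicator (fun _ => 1) z
    + (τ ⁻¹' {θ}).indicator (fun _ => w₀) z with hw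
  have hwlt : ∀ z, τ z < θ → w z = 1 := fun z hz => by
    simp [hw, hz, hz.ne]
  have hweq : ∀ z, τ z = θ → w z = w₀ := fun z hz => by simp [hw, hz]
  have hwgt : ∀ z, θ < τ z → w z = 0 := fun z hz => by simp [hw, hz.ne', hz.le]
  have hwm : Measurable w :=
    (measurable_const.indicator hLt).add (measurable_const.indicator hEq)
  refine ⟨θ, w, hθ, hwm, fun z => ?_, fun z => ?_, ?_, fun z => ?_⟩
  · rcases lt_trichotomy (τ z) θ with h | h | h
    · simp [hwlt z h]
    · simpa [hweq z h] using hw₀0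
    · simp [hwgt z h]
  · rcases lt_trichotomy (τ z) θ with h | h | h
    · simp [hwlt z h]
    · simpa [hweq z h] using hw₀1
    · simp [hwgt z h]
  · have hi1 : Integrable ((τ ⁻¹' Set.Iio θ).indicator fun _ => (1 : ℝ)) P :=
      (integrable_const _).indicator hLt
    have hi2 : Integrable ((τ ⁻¹' {θ}).indicator fun _ => w₀) P :=
      (integrable_const _).indicator hEq
    have hwi : ∫ z, w z ∂P = 1 - a := by
      rw [hw, integral_add hi1 hi2, integral_indicator_const _ hLt, integral_indicator_const _ hEq]
      simp only [smul_eq_mul]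
      linarith
    have hwI : Integrable w P := hi1.add hi2
    rw [integral_sub (integrable_const _) hwI, hwi]
    simp
  · rcases lt_trichotomy (τ z) θ with h | h | h
    · rw [hwlt z h, min_eq_left h.le]; ring
    · rw [hweq z h, h, min_self]; ring
    · rw [hwgt z h, min_eq_right h.le]; ring

/-- Hoeffding's inequality for the lower tail of an average. -/
theorem measureReal_average_le {𝒵 : Type*} [MeasurableSpace 𝒵] (P : Measure 𝒵)
    [IsProbabilityMeasure P] {n : ℕ} [NeZero n] {G : 𝒵 → ℝ} (hG : Measurable G)
    (hG0 : ∀ z, 0 ≤ G z) (hG1 : ∀ z, G z ≤ 1) {a : ℝ} (ha : 0 ≤ a) :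
    (Measure.pi fun _ : Fin n => P).real {z | ∑ i, G (z i) ≤ n * (∫ x, G x ∂P - a)}
      ≤ Real.exp (-(2 * n * a ^ 2)) := by
  have hn : (0 : ℝ) < n := Nat.cast_pos.2 (NeZero.pos n)
  have hG' : ∀ z, |G z| ≤ 1 := fun z => by rw [abs_of_nonneg (hG0 z)]; exact hG1 z
  have hGi : Integrable G P := integrable_of_forall_abs_le hG hG'
  have hSm : Measurable fun z : Fin n → 𝒵 => -∑ i, G (z i) :=
    (Finset.measurable_sum _ fun i _ => hG.comp (measurable_pi_apply i)).neg
  have hSC : ∀ z : Fin n → 𝒵, |-∑ i, G (z i)| ≤ n := fun z => by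
    rw [abs_neg]
    refine (Finset.abs_sum_le_sum_abs _ _).trans ((Finset.sum_le_sum fun i _ => hG' (z i)).trans ?_)
    simp
  -- The parameter `4a` minimizes `s²n/8 - sna` over `s`.
  have h := integral_exp_le_of_bounded_differences P hSm hSC (c := fun _ => 1) (fun i z x => by
    rw [neg_sub_neg, ← Finset.sum_sub_distrib, Finset.sum_eq_single i]
    · rw [Function.update_self]
      linarith [hG0 x, hG1 (z i)]
    · intro j _ hj
      rw [Function.update_of_ne hj, sub_self]
    · simp) (4 * a)
  have hint : ∫ z : Fin n → 𝒵, -∑ i, G (z i) ∂(Measure.pi fun _ => P) = -(n * ∫ x, G x ∂P) := by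
    rw [integral_neg, integral_finsetSum _ fun i _ => integrable_pi_eval hGi i]
    simp only [integral_pi_eval P hG]
    simp
  rw [hint] at h
  have hmk := mul_meas_ge_le_integral_of_nonneg
    (Filter.Eventually.of_forall fun z : Fin n → 𝒵 => (Real.exp_pos (4 * a * -∑ i, G (z i))).le)
    (integrable_exp_mul_of_forall_abs_le (μ := Measure.pi fun _ : Fin n => P) hSm hSC (4 * a))
    (Real.exp (4 * a * -(n * (∫ x, G x ∂P - a))))
  have h1 := hmk.trans h
  rw [← le_div_iff₀' (Real.exp_pos _), ← Real.exp_sub] at h1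
  refine (measureReal_mono ?_).trans (h1.trans (le_of_eq ?_))
  · intro z hz
    simp only [Set.mem_ofPred_eq] at hz ⊢
    exact Real.exp_le_exp.2 (mul_le_mul_of_nonneg_left (neg_le_neg hz) (by linarith))
  · congr 1
    simp
    ring

/-! ### Measurability of suprema over a possibly nonseparable ball -/

/-- The supremum over a ball of Hilbert space of a continuous function of finitely many inner
products depends measurably on the vectors, as soon as their Gram matrix does. -/
theorem measurable_iSup_closedBall {E 𝒵 ι : Type*} [NormedAddCommGroup E] [InnerProductSpace ℝ E]
    [MeasurableSpace 𝒵] [Fintype ι] {x : 𝒵 → E}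
    (hx : Measurable fun q : 𝒵 × 𝒵 => inner ℝ (x q.1) (x q.2)) {A : 𝒵 → ℝ → ℝ}
    (hA : Measurable (Function.uncurry A)) (hAc : ∀ z, Continuous (A z))
    (hA1 : ∀ z u, |A z u| ≤ 1) {Λ : ℝ} (hΛ : 0 < Λ) (v : ι → ℝ) :
    Measurable fun z : ι → 𝒵 =>
      ⨆ f : Metric.closedBall (0 : E) Λ, ∑ i, v i * A (z i) (inner ℝ (f : E) (x (z i))) := by
  classical
  set S : (ι → 𝒵) → (ι → ℝ) → E := fun z q => ∑ j, q j • x (z j) with hS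
  -- Radial retraction onto the ball: every coefficient vector gives an admissible point,
  -- continuously in the coefficients, so rational coefficients exhaust the supremum.
  set r : (ι → 𝒵) → (ι → ℝ) → ℝ := fun z q => Λ / max Λ ‖S z q‖ with hr
  set T : (ι → 𝒵) → (ι → ℝ) → ℝ := fun z q =>
    ∑ i, v i * A (z i) (r z q * ∑ j, q j * inner ℝ (x (z j)) (x (z i))) with hT
  have hmax : ∀ z q, 0 < max Λ ‖S z q‖ := fun z q => lt_max_of_lt_left hΛ
  have hin : ∀ z q i, inner ℝ (r z q • S z q) (x (z i))
      = r z q * ∑ j, q j * inner ℝ (x (z j)) (x (z i)) := fun z q i => by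
    simp [hS, inner_smul_left, sum_inner]
  have hmem : ∀ z q, r z q • S z q ∈ Metric.closedBall (0 : E) Λ := fun z q => by
    rw [mem_closedBall_zero_iff, norm_smul, Real.norm_eq_abs,
      abs_of_nonneg (div_nonneg hΛ.le (hmax z q).le), div_mul_eq_mul_div,
      div_le_iff₀ (hmax z q)]
    exact mul_le_mul_of_nonneg_left (le_max_right _ _) hΛ.le
  have hgram : ∀ i j, Measurable fun z : ι → 𝒵 => inner ℝ (x (z i)) (x (z j)) := fun i j => by
    have h2 : Measurable fun z : ι → 𝒵 => (z i, z j) :=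
      (measurable_pi_apply i).prodMk (measurable_pi_apply j)
    exact hx.comp h2
  have hTm : ∀ q, Measurable fun z => T z q := fun q => by
    have hnorm : Measurable fun z => ‖S z q‖ := by
      have : (fun z => ‖S z q‖)
          = fun z => √(∑ i, ∑ j, q i * (q j * inner ℝ (x (z i)) (x (z j)))) := by
        ext z
        rw [norm_eq_sqrt_real_inner, hS]
        congr 1
        simp only [sum_inner, inner_sum, inner_smul_left, inner_smul_right, RCLike.conj_to_real,
          Finset.mul_sum]
        exact Finset.sum_congr rfl fun i _ => Finset.sum_congr rfl fun j _ => by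
          rw [real_inner_comm]
      rw [this]
      exact (Finset.measurable_sum _ fun i _ => Finset.measurable_sum _ fun j _ =>
        ((hgram i j).const_mul _).const_mul _).sqrt
    have hrm : Measurable fun z => r z q := measurable_const.div (measurable_const.max hnorm)
    refine Finset.measurable_sum _ fun i _ => Measurable.const_mul ?_ _
    exact hA.comp ((measurable_pi_apply i).prodMk (hrm.mul
      (Finset.measurable_sum _ fun j _ => (hgram j i).const_mul _)))
  have hTc : ∀ z, Continuous (T z) := fun z => by
    have hSc : Continuous (S z) := by fun_prop
    have hrc : Continuous (r z) :=
      continuous_const.div (continuous_const.max hSc.norm) fun q => (hmax z q).ne'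
    refine continuous_finsetSum _ fun i _ => continuous_const.mul ((hAc (z i)).comp ?_)
    fun_prop
  have hdense : DenseRange fun (q : ι → ℚ) (i : ι) => (q i : ℝ) :=
    DenseRange.piMap fun _ => Rat.denseRange_cast
  have hne : Nonempty (Metric.closedBall (0 : E) Λ) := ⟨⟨0, by simp [hΛ.le]⟩⟩
  have hTabs : ∀ z q, |T z q| ≤ ∑ i, |v i| := fun z q => abs_sum_mul_le_sum_abs (fun i => hA1 _ _) v
  have key : ∀ z : ι → 𝒵,
      (⨆ f : Metric.closedBall (0 : E) Λ, ∑ i, v i * A (z i) (inner ℝ (f : E) (x (z i))))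
        = ⨆ q : ι → ℚ, T z fun i => (q i : ℝ) := by
    intro z
    have hb1 : BddAbove (Set.range fun q : ι → ℚ => T z fun i => (q i : ℝ)) :=
      bddAbove_range_of_abs_le fun q => hTabs z _
    have hb2 : BddAbove (Set.range fun f : Metric.closedBall (0 : E) Λ =>
        ∑ i, v i * A (z i) (inner ℝ (f : E) (x (z i)))) :=
      bddAbove_range_of_abs_le fun f => abs_sum_mul_le_sum_abs (fun i => hA1 _ _) v
    refine le_antisymm (ciSup_le fun f => ?_) (ciSup_le fun q => ?_)
    · have hTle : ∀ c, T z c ≤ ⨆ q : ι → ℚ, T z fun i => (q i : ℝ) := fun c =>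
        hdense.induction_on (p := fun c => T z c ≤ ⨆ q : ι → ℚ, T z fun i => (q i : ℝ)) c
          (isClosed_le (hTc z) continuous_const) fun q => le_ciSup hb1 q
      -- Only the projection of `f` onto the span of the sample vectors is seen by the inner
      -- products, and projecting does not leave the ball.
      set U : Submodule ℝ E := Submodule.span ℝ (Set.range fun i => x (z i)) with hU
      have hUf : FiniteDimensional ℝ U := FiniteDimensional.span_of_finite ℝ (Set.finite_range _)
      obtain ⟨c, hc⟩ := (Submodule.mem_span_range_iff_exists_fun ℝ).1
        (Submodule.starProjection_apply_mem U (f : E))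
      have hSc : S z c = U.starProjection (f : E) := hc
      have hle : ‖S z c‖ ≤ Λ := by
        rw [hSc]
        exact (U.norm_starProjection_apply_le _).trans (mem_closedBall_zero_iff.1 f.2)
      have hr1 : r z c = 1 := by rw [hr]; simp only; rw [max_eq_left hle, div_self hΛ.ne']
      refine le_trans (le_of_eq (Finset.sum_congr rfl fun i _ => ?_)) (hTle c)
      congr 2
      rw [← hin, hr1, one_smul, hSc]
      have h0 := U.starProjection_inner_eq_zero (f : E) (x (z i))
        (Submodule.subset_span ⟨i, rfl⟩)
      rw [inner_sub_left] at h0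
      linarith
    · refine le_trans (le_of_eq (Finset.sum_congr rfl fun i _ => ?_))
        (le_ciSup hb2 ⟨_, hmem z fun i => (q i : ℝ)⟩)
      simp only [hin]
  simp only [key]
  exact Measurable.iSup fun q => hTm _

/-! ### Kernel sections and measurability in the RKHS -/

section Kernel

variable {𝒳 H : Type*} [NormedAddCommGroup H] [InnerProductSpace ℝ H] [CompleteSpace H]
  [RKHS ℝ H 𝒳 ℝ] {k : 𝒳 → 𝒳 → ℝ}

theorem inner_kerFun_one (f : H) (x : 𝒳) : inner ℝ f (RKHS.kerFun H x (1 : ℝ)) = f x := by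
  simp

theorem IsRKHSOfKernel.kerFun_apply (hH : IsRKHSOfKernel H k) (x y : 𝒳) :
    (RKHS.kerFun H x (1 : ℝ)) y = k y x := by
  rw [RKHS.kerFun_apply, hH]

theorem IsRKHSOfKernel.inner_kerFun (hH : IsRKHSOfKernel H k) (x y : 𝒳) :
    inner ℝ (RKHS.kerFun H x (1 : ℝ)) (RKHS.kerFun H y (1 : ℝ)) = k y x := by
  rw [inner_kerFun_one, hH.kerFun_apply]

theorem IsRKHSOfKernel.norm_kerFun_sq (hH : IsRKHSOfKernel H k) (x : 𝒳) :
    ‖RKHS.kerFun H x (1 : ℝ)‖ ^ 2 = k x x := by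
  rw [← real_inner_self_eq_norm_sq, hH.inner_kerFun]

theorem IsRKHSOfKernel.self_nonneg (hH : IsRKHSOfKernel H k) (x : 𝒳) : 0 ≤ k x x := by
  rw [← hH.norm_kerFun_sq]; positivity

/-- The elements of the reproducing kernel Hilbert space of a measurable kernel are measurable. -/
theorem IsRKHSOfKernel.measurable_coe [MeasurableSpace 𝒳] (hH : IsRKHSOfKernel H k)
    (hk : Measurable (Function.uncurry k)) (f : H) : Measurable (f : 𝒳 → ℝ) := by
  have hspan : ∀ g ∈ Submodule.span ℝ {RKHS.kerFun H x v | (x : 𝒳) (v : ℝ)},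
      Measurable (g : 𝒳 → ℝ) := by
    intro g hg
    induction hg using Submodule.span_induction with
    | mem g hg =>
      obtain ⟨x, v, rfl⟩ := hg
      have : RKHS.kerFun H x v = v • RKHS.kerFun H x (1 : ℝ) := by
        rw [← map_smul]; simp
      rw [this, RKHS.coe_smul]
      have h1 : (RKHS.kerFun H x (1 : ℝ) : 𝒳 → ℝ) = fun y => k y x :=
        funext fun y => hH.kerFun_apply x y
      rw [h1]
      exact (hk.comp (measurable_id.prodMk measurable_const)).const_smul v
    | zero => rw [RKHS.coe_zero]; exact measurable_const
    | add g h _ _ hg hh => rw [RKHS.coe_add]; exact hg.add hh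
    | smul c g _ hg => rw [RKHS.coe_smul]; exact hg.const_smul c
  -- Kernel sections span a dense subspace, and norm convergence implies pointwise convergence.
  have hf : f ∈ closure (Submodule.span ℝ {RKHS.kerFun H x v | (x : 𝒳) (v : ℝ)} : Set H) := by
    rw [← Submodule.topologicalClosure_coe, RKHS.kerFun_dense]
    trivial
  obtain ⟨u, hu, hlim⟩ := mem_closure_iff_seq_limit.1 hf
  refine measurable_of_tendsto_metrizable (fun i => hspan (u i) (hu i)) ?_
  rw [tendsto_pi_nhds]
  intro x
  exact ((RKHS.continuous_eval x).tendsto f).comp hlim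

end Kernel

/-! ### The ramp and the sign -/

/-- The ramp function with scale `γ`, the complement of the margin loss. -/
noncomputable def ramp (γ u : ℝ) : ℝ := max 0 (min 1 (u / γ))

section Ramp

variable {γ : ℝ}

theorem ramp_eq_one_sub_marginLoss (hγ : 0 < γ) (u : ℝ) : ramp γ u = 1 - marginLoss γ u := by
  unfold ramp marginLoss
  split_ifs with h1 h2
  · rw [max_eq_left ((min_le_right _ _).trans (div_nonpos_of_nonpos_of_nonneg h1 hγ.le))]; ring
  · have h3 : u / γ ≤ 1 := (div_le_one hγ).2 h2
    rw [min_eq_right h3, max_eq_right (div_nonneg (not_le.1 h1).le hγ.le)]; ring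
  · have h3 : 1 ≤ u / γ := (one_le_div hγ).2 (not_le.1 h2).le
    rw [min_eq_left h3, max_eq_right zero_le_one]; ring

theorem ramp_nonneg (γ u : ℝ) : 0 ≤ ramp γ u := le_max_left _ _

theorem ramp_le_one (γ u : ℝ) : ramp γ u ≤ 1 := max_le zero_le_one (min_le_left _ _)

theorem ramp_of_nonpos (hγ : 0 < γ) {u : ℝ} (hu : u ≤ 0) : ramp γ u = 0 :=
  max_eq_left ((min_le_right _ _).trans (div_nonpos_of_nonpos_of_nonneg hu hγ.le))

theorem ramp_le_abs_div (hγ : 0 < γ) (u : ℝ) : ramp γ u ≤ |u| / γ :=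
  max_le (by positivity) ((min_le_right _ _).trans
    (div_le_div_of_nonneg_right (le_abs_self u) hγ.le))

/-- Monotonicity and the Lipschitz constant `1/γ` in a single one-sided inequality, the form needed
for contraction with `p ≠ 1/2`. -/
theorem ramp_sub_ramp_le (γ u v : ℝ) : ramp γ u - ramp γ v ≤ max 0 (u / γ - v / γ) := by
  rw [sub_le_iff_le_add]
  refine max_le (add_nonneg (le_max_left _ _) (ramp_nonneg _ _)) ?_
  rcases le_total 1 (v / γ) with hv | hv
  · have : ramp γ v = 1 := by unfold ramp; rw [min_eq_left hv, max_eq_right zero_le_one]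
    rw [this]
    linarith [min_le_left 1 (u / γ), le_max_left 0 (u / γ - v / γ)]
  · have : v / γ ≤ ramp γ v := by unfold ramp; rw [min_eq_right hv]; exact le_max_right _ _
    linarith [min_le_right 1 (u / γ), le_max_right 0 (u / γ - v / γ)]

theorem continuous_ramp (γ : ℝ) : Continuous (ramp γ) := by
  unfold ramp; fun_prop

end Ramp

theorem measurable_sign : Measurable Real.sign := by
  have : Real.sign = fun r : ℝ => if r < 0 then -1 else if 0 < r then 1 else 0 := by
    ext r; rfl
  rw [this]
  exact Measurable.ite measurableSet_Iio measurable_const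
    (Measurable.ite measurableSet_Ioi measurable_const measurable_const)

theorem abs_sign_le_one (y : ℝ) : |Real.sign y| ≤ 1 := by
  rcases Real.sign_apply_eq y with h | h | h <;> simp [h]

theorem sign_mul_nonpos {y u : ℝ} (h : y * u ≤ 0) : Real.sign y * u ≤ 0 := by
  rcases lt_trichotomy y 0 with hy | hy | hy
  · rw [Real.sign_of_neg hy]; nlinarith
  · simp [hy]
  · rw [Real.sign_of_pos hy]; nlinarith

/-! ### Deviation of weighted margins over one ball -/

section Margin

variable {𝒳 H : Type*} [MeasurableSpace 𝒳] [NormedAddCommGroup H] [InnerProductSpace ℝ H]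
  [CompleteSpace H] [RKHS ℝ H 𝒳 ℝ] {k : 𝒳 → 𝒳 → ℝ}

theorem IsRKHSOfKernel.measurable_margin (hH : IsRKHSOfKernel H k)
    (hk : Measurable (Function.uncurry k)) (γ : ℝ) (f : H) :
    Measurable fun z : 𝒳 × ℝ => ramp γ (Real.sign z.2 * f z.1) :=
  (continuous_ramp γ).measurable.comp
    ((measurable_sign.comp measurable_snd).mul ((hH.measurable_coe hk f).comp measurable_fst))

theorem measurable_kernel_diag (hk : Measurable (Function.uncurry k)) :
    Measurable fun z : 𝒳 × ℝ => k z.1 z.1 :=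
  hk.comp (measurable_fst.prodMk measurable_fst)

/-- A one-sided deviation inequality for the weighted margins of the functions in a ball of the
reproducing kernel Hilbert space. -/
theorem IsRKHSOfKernel.exists_margin_deviation (hH : IsRKHSOfKernel H k)
    (hk : Measurable (Function.uncurry k)) {κ : ℝ} (hκ : ∀ x, k x x ≤ κ) {γ : ℝ} (hγ : 0 < γ)
    (P : Measure (𝒳 × ℝ)) [IsProbabilityMeasure P] {w : 𝒳 × ℝ → ℝ} (hw : Measurable w)
    (hw0 : ∀ z, 0 ≤ w z) (hw1 : ∀ z, w z ≤ 1) {n : ℕ} [NeZero n] (hn : 15 / 4 ≤ √(n : ℝ))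
    {Λ t : ℝ} (hΛ : 0 < Λ)
    (ht : 6 / 5 * (Λ * √(∫ z, w z * k z.1 z.1 ∂P) / (γ * √n)) < t) :
    ∃ B : Set (Fin n → 𝒳 × ℝ), MeasurableSet B ∧
      (Measure.pi fun _ => P).real B ≤ Real.exp (-(2 * n / (101 / 100) *
        (t - 6 / 5 * (Λ * √(∫ z, w z * k z.1 z.1 ∂P) / (γ * √n))) ^ 2)) ∧
      ∀ z, z ∉ B → ∀ f : H, ‖f‖ ≤ Λ →
        (∑ i, (w (z i) * ramp γ (Real.sign (z i).2 * f (z i).1) + (1 - w (z i)))) / n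
          - ∫ z, (w z * ramp γ (Real.sign z.2 * f z.1) + (1 - w z)) ∂P < t := by
  have hn0 : (0 : ℝ) < n := Nat.cast_pos.2 (NeZero.pos n)
  have hsn : 0 < √(n : ℝ) := Real.sqrt_pos.2 hn0
  set M : ℝ := 6 / 5 * (Λ * √(∫ z, w z * k z.1 z.1 ∂P) / (γ * √n)) with hMdef
  -- A ghost sample of size `100n` makes `1/n + 1/m` equal to `1.01/n`, close to the value `1/n` of
  -- an infinite ghost sample.
  have : NeZero (100 * n) := ⟨by have := NeZero.ne n; omega⟩
  set c : ℝ := (n : ℝ)⁻¹ + ((100 * n : ℕ) : ℝ)⁻¹ with hc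
  have hcv : c = 101 / 100 / n := by rw [hc]; push_cast; field_simp; norm_num
  have hc0 : 0 < c := by rw [hcv]; positivity
  set a : Metric.closedBall (0 : H) Λ → 𝒳 × ℝ → ℝ := fun f z =>
    w z * ramp γ (Real.sign z.2 * (f : H) z.1) with ha
  have ha0 : ∀ f z, 0 ≤ a f z := fun f z => mul_nonneg (hw0 z) (ramp_nonneg _ _)
  have hale : ∀ f z, a f z ≤ w z := fun f z => mul_le_of_le_one_right (hw0 z) (ramp_le_one _ _)
  have ha1 : ∀ f z, |a f z| ≤ 1 := fun f z => by
    rw [abs_of_nonneg (ha0 f z)]; exact (hale f z).trans (hw1 z)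
  have ham : ∀ f, Measurable (a f) := fun f => hw.mul (hH.measurable_margin hk γ f)
  have hgram : Measurable fun q : (𝒳 × ℝ) × (𝒳 × ℝ) =>
      inner ℝ (RKHS.kerFun H q.1.1 (1 : ℝ)) (RKHS.kerFun H q.2.1 (1 : ℝ)) := by
    simp only [hH.inner_kerFun]
    exact hk.comp ((measurable_fst.comp measurable_snd).prodMk
      (measurable_fst.comp measurable_fst))
  have hAm : Measurable (Function.uncurry fun (z : 𝒳 × ℝ) (u : ℝ) =>
      w z * ramp γ (Real.sign z.2 * u)) :=
    (hw.comp measurable_fst).mul ((continuous_ramp γ).measurable.comp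
      ((measurable_sign.comp (measurable_snd.comp measurable_fst)).mul measurable_snd))
  have hcr := continuous_ramp γ
  have hsupa : ∀ v : Fin n ⊕ Fin (100 * n) → ℝ,
      Measurable fun z : Fin n ⊕ Fin (100 * n) → 𝒳 × ℝ => ⨆ f, ∑ i, v i * a f (z i) := fun v => by
    have := measurable_iSup_closedBall (E := H) (x := fun z : 𝒳 × ℝ => RKHS.kerFun H z.1 (1 : ℝ))
      hgram hAm (fun z => by fun_prop) (fun z u => by
        rw [abs_of_nonneg (mul_nonneg (hw0 z) (ramp_nonneg _ _))]
        exact (mul_le_of_le_one_right (hw0 z) (ramp_le_one _ _)).trans (hw1 z)) hΛ v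
    simpa only [inner_kerFun_one] using this
  have hne : Nonempty (Metric.closedBall (0 : H) Λ) := ⟨⟨0, by simp [hΛ.le]⟩⟩
  have hbdd : ∀ z : Fin n ⊕ Fin (100 * n) → 𝒳 × ℝ,
      BddAbove (Set.range fun f => ∑ i, ghostWeight n (100 * n) i * a f (z i)) := fun z =>
    bddAbove_range_of_abs_le fun f => abs_sum_mul_le_sum_abs (fun i => ha1 f (z i)) _
  -- The part `1 - w` does not depend on `f`, so it leaves the supremum; its ghost difference has
  -- mean zero.
  have hsplit : ∀ z : Fin n ⊕ Fin (100 * n) → 𝒳 × ℝ,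
      (⨆ f, ∑ i, ghostWeight n (100 * n) i * (a f (z i) + (1 - w (z i))))
        = (⨆ f, ∑ i, ghostWeight n (100 * n) i * a f (z i))
          + ∑ i, ghostWeight n (100 * n) i * (1 - w (z i)) := fun z => by
    rw [ciSup_add (hbdd z)]
    simp only [mul_add, Finset.sum_add_distrib]
  have hrm : Measurable fun z : Fin n ⊕ Fin (100 * n) → 𝒳 × ℝ =>
      ∑ i, ghostWeight n (100 * n) i * (1 - w (z i)) :=
    Finset.measurable_sum _ fun i _ =>
      (measurable_const.sub (hw.comp (measurable_pi_apply i))).const_mul _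
  have hw1' : ∀ z, |1 - w z| ≤ 1 := fun z => abs_le.2 ⟨by linarith [hw1 z], by linarith [hw0 z]⟩
  have hri : Integrable (fun z => 1 - w z) P :=
    integrable_of_forall_abs_le (measurable_const.sub hw) hw1'
  have hr0 : ∫ z : Fin n ⊕ Fin (100 * n) → 𝒳 × ℝ,
      ∑ i, ghostWeight n (100 * n) i * (1 - w (z i)) ∂(Measure.pi fun _ => P) = 0 := by
    rw [integral_finsetSum _ fun i _ => (integrable_pi_eval hri i).const_mul _]
    simp only [integral_const_mul]
    have : ∀ i : Fin n ⊕ Fin (100 * n), ∫ z : Fin n ⊕ Fin (100 * n) → 𝒳 × ℝ, (1 - w (z i))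
        ∂(Measure.pi fun _ => P) = ∫ z, (1 - w z) ∂P := fun i =>
      integral_pi_eval P (measurable_const.sub hw) i
    simp only [this]
    rw [sum_ghostWeight_mul]
    simp
    field_simp
    ring
  set τ : 𝒳 × ℝ → ℝ := fun z => w z * k z.1 z.1 / γ ^ 2 with hτ
  have hk0 := hH.self_nonneg
  have hκ0 : ∀ z : 𝒳 × ℝ, |w z * k z.1 z.1| ≤ κ := fun z => by
    rw [abs_of_nonneg (mul_nonneg (hw0 z) (hk0 _))]
    exact (mul_le_of_le_one_left (hk0 _) (hw1 z)).trans (hκ _)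
  have hwkm : Measurable fun z : 𝒳 × ℝ => w z * k z.1 z.1 := hw.mul (measurable_kernel_diag hk)
  have hτm : Measurable τ := hwkm.div_const _
  have hτi : Integrable τ P := (integrable_of_forall_abs_le hwkm hκ0).div_const _
  have hmean := integral_iSup_ghostWeight_le P (n := n) (m := 100 * n) hΛ.le ha1
    ⟨⟨0, by simp [hΛ.le]⟩, fun z => by simp [ha, ramp_of_nonpos hγ le_rfl]⟩
    (fun z => (w z * Real.sign z.2 / γ) • RKHS.kerFun H z.1 (1 : ℝ))
    (fun f g z => by
      simp only [inner_smul_right, inner_kerFun_one, ha, ← mul_sub]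
      refine (mul_le_mul_of_nonneg_left (ramp_sub_ramp_le γ _ _) (hw0 z)).trans (le_of_eq ?_)
      rw [mul_max_of_nonneg _ _ (hw0 z), mul_zero]
      congr 1
      ring)
    hsupa hτi hτm (fun z => by
      rw [norm_smul, mul_pow, hH.norm_kerFun_sq, Real.norm_eq_abs, sq_abs, hτ]
      have h1 : Real.sign z.2 ^ 2 ≤ 1 := by
        rw [← sq_abs]; nlinarith [abs_sign_le_one z.2, abs_nonneg (Real.sign z.2)]
      have h2 : w z ^ 2 ≤ w z := by nlinarith [hw0 z, hw1 z]
      have h3 : (w z * Real.sign z.2 / γ) ^ 2 ≤ w z / γ ^ 2 := by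
        rw [div_pow, mul_pow]
        refine div_le_div_of_nonneg_right ?_ (by positivity)
        nlinarith [hw0 z, sq_nonneg (w z)]
      refine (mul_le_mul_of_nonneg_right h3 (hk0 _)).trans (le_of_eq (by ring)))
  rw [← hc] at hmean
  have hEle : ∫ z, (⨆ f, ∑ i, ghostWeight n (100 * n) i * a f (z i)) ∂(Measure.pi fun _ => P)
      ≤ M := by
    set I := ∫ z, (⨆ f, ∑ i, ghostWeight n (100 * n) i * a f (z i)) ∂(Measure.pi fun _ => P)
    set V := ∫ z, w z * k z.1 z.1 ∂P with hV
    have hV0 : 0 ≤ V := integral_nonneg fun z => mul_nonneg (hw0 z) (hk0 _)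
    have hτV : ∫ z, τ z ∂P = V / γ ^ 2 := by rw [hτ, integral_div]
    -- `201/200` bounds `√1.01`; with `√n ≥ 15/4` this gives `√c ≤ 67/250`, and `(201/200)/(1 -
    -- 67/500) < 6/5`.
    have hsc : √c ≤ 201 / 200 / √n := by
      rw [hcv, Real.sqrt_div (by norm_num)]
      refine div_le_div_of_nonneg_right ?_ hsn.le
      rw [Real.sqrt_le_left (by norm_num)]
      norm_num
    have hsc2 : √c ≤ 67 / 250 := hsc.trans (by
      rw [div_le_iff₀ hsn]; nlinarith)
    have hrhs : Λ * √(c * ∫ z, τ z ∂P) ≤ 201 / 200 * (Λ * √V / (γ * √n)) := by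
      rw [hτV, Real.sqrt_mul hc0.le, Real.sqrt_div hV0, Real.sqrt_sq hγ.le]
      have h1 : √c * (√V / γ) ≤ 201 / 200 / √n * (√V / γ) :=
        mul_le_mul_of_nonneg_right hsc (by positivity)
      calc Λ * (√c * (√V / γ)) ≤ Λ * (201 / 200 / √n * (√V / γ)) :=
            mul_le_mul_of_nonneg_left h1 hΛ.le
        _ = _ := by field_simp
    set D := Λ * √V / (γ * √n) with hD
    have hD0 : 0 ≤ D := by positivity
    have h1 := hmean.trans hrhs
    by_contra hlt
    have hlt' : 6 / 5 * D < I := not_le.1 hlt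
    have hI0 : 0 ≤ I := (by positivity : (0 : ℝ) ≤ 6 / 5 * D).trans hlt'.le
    have h2 : (1 - 67 / 500) * I ≤ (1 - √c / 2) * I :=
      mul_le_mul_of_nonneg_right (by linarith) hI0
    linarith
  obtain ⟨B, hBm, hBle, hB⟩ := exists_measure_le_forall_average_sub_integral_lt P (n := n)
    (m := 100 * n) (g := fun f z => a f z + (1 - w z))
    (fun f => (ham f).add (measurable_const.sub hw))
    (fun f z => add_nonneg (ha0 f z) (by linarith [hw1 z]))
    (fun f z => by linarith [hale f z])
    (by simp only [hsplit]; exact (hsupa _).add hrm)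
    (M := M) (t := t) (by
      simp only [hsplit]
      rw [integral_add (integrable_of_forall_abs_le (hsupa _) fun z =>
          abs_ciSup_le fun f => abs_sum_mul_le_sum_abs (fun i => ha1 f (z i)) _)
        (integrable_of_forall_abs_le hrm fun z => abs_sum_mul_le_sum_abs (fun i => hw1' _) _),
        hr0, add_zero]
      exact hEle) ht
  refine ⟨B, hBm, hBle.trans (le_of_eq ?_), fun z hz f hf =>
    hB z hz ⟨f, mem_closedBall_zero_iff.2 hf⟩⟩
  rw [← hc, hcv]
  congr 1
  field_simp

end Margin

/-! ### Summation over shells -/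

/-- Gaussian tails at the points of an arithmetic progression add up to less than the leading
factor. -/
theorem sum_range_exp_le {L : ℝ} (hL : Real.log 2 ≤ L) (J : ℕ) :
    ∑ j ∈ Finset.range J, Real.exp (-(L * (14 / 5 + 3 / 5 * j))) ≤ Real.exp (-L) := by
  set y := Real.exp (-(3 / 5 * L)) with hy
  have hy0 : 0 < y := Real.exp_pos _
  -- Since `14/5 = 1 + 3·(3/5)`, the sum is `exp(-L)·y³` times a geometric sum, so `y³ ≤ 1 - y` is
  -- enough; `L ≥ log 2` gives `y ≤ 33/50`, which implies it.
  have hy5 : y ^ 5 ≤ (1 / 2) ^ 3 := by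
    have h1 : Real.exp (-L) ≤ 1 / 2 := by
      calc Real.exp (-L) ≤ Real.exp (-Real.log 2) := Real.exp_le_exp.2 (neg_le_neg hL)
        _ = 1 / 2 := by rw [Real.exp_neg, Real.exp_log two_pos]; norm_num
    have h2 : y ^ 5 = Real.exp (-L) ^ 3 := by
      rw [hy, ← Real.exp_nat_mul, ← Real.exp_nat_mul]; congr 1; push_cast; ring
    rw [h2]
    exact pow_le_pow_left₀ (Real.exp_pos _).le h1 3
  have hy1 : y ≤ 33 / 50 := by
    by_contra hlt
    have := pow_lt_pow_left₀ (not_le.1 hlt) (by norm_num) (n := 5) (by norm_num)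
    norm_num at this hy5
    linarith
  have hterm : ∀ j : ℕ, Real.exp (-(L * (14 / 5 + 3 / 5 * j))) = Real.exp (-L) * y ^ 3 * y ^ j :=
    fun j => by
      rw [hy, ← Real.exp_nat_mul, ← Real.exp_nat_mul, ← Real.exp_add, ← Real.exp_add]
      congr 1
      push_cast
      ring
  simp only [hterm]
  rw [← Finset.mul_sum, mul_assoc]
  refine mul_le_of_le_one_right (Real.exp_pos _).le ?_
  have hgeom := mul_neg_geom_sum y J
  have hS : (∑ j ∈ Finset.range J, y ^ j) * (1 - y) ≤ 1 := by
    rw [mul_comm, hgeom]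
    linarith [pow_nonneg hy0.le J]
  have h3 : y ^ 3 ≤ 1 - y := by
    have : y ^ 3 ≤ (33 / 50) ^ 3 := pow_le_pow_left₀ hy0.le hy1 3
    norm_num at this
    linarith
  have hS0 : 0 ≤ ∑ j ∈ Finset.range J, y ^ j := Finset.sum_nonneg fun j _ => pow_nonneg hy0.le j
  nlinarith

/-! ### Trace bounds, interpolation, and peeling over the norm -/

section Margin

variable {𝒳 H : Type*} [NormedAddCommGroup H] [InnerProductSpace ℝ H]
  [CompleteSpace H] [RKHS ℝ H 𝒳 ℝ] {k : 𝒳 → 𝒳 → ℝ}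

theorem IsRKHSOfKernel.abs_apply_le (hH : IsRKHSOfKernel H k) (f : H) (x : 𝒳) :
    |f x| ≤ ‖f‖ * √(k x x) := by
  rw [← inner_kerFun_one f x, ← hH.norm_kerFun_sq, Real.sqrt_sq (norm_nonneg _)]
  exact abs_real_inner_le_norm _ _

/-- The average margin over the sample, bounded by the trace of the kernel matrix. -/
theorem IsRKHSOfKernel.average_ramp_le (hH : IsRKHSOfKernel H k) {γ : ℝ} (hγ : 0 < γ) {n : ℕ}
    [NeZero n] (z : Fin n → 𝒳 × ℝ) (f : H) :
    (∑ i, ramp γ (Real.sign (z i).2 * f (z i).1)) / n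
      ≤ ‖f‖ * √(∑ i, k (z i).1 (z i).1) / (γ * √n) := by
  have hn0 : (0 : ℝ) < n := Nat.cast_pos.2 (NeZero.pos n)
  have hsn : 0 < √(n : ℝ) := Real.sqrt_pos.2 hn0
  have hsq : √(n : ℝ) ^ 2 = n := Real.sq_sqrt hn0.le
  have hcs : ∑ i, √(k (z i).1 (z i).1) ≤ √n * √(∑ i, k (z i).1 (z i).1) := by
    rw [← Real.sqrt_mul hn0.le]
    refine Real.le_sqrt_of_sq_le ?_
    have := sq_sum_le_card_mul_sum_sq (s := (Finset.univ : Finset (Fin n)))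
      (f := fun i => √(k (z i).1 (z i).1))
    simpa [Real.sq_sqrt (hH.self_nonneg _)] using this
  have h1 : ∑ i, ramp γ (Real.sign (z i).2 * f (z i).1)
      ≤ ‖f‖ / γ * ∑ i, √(k (z i).1 (z i).1) := by
    rw [Finset.mul_sum]
    refine Finset.sum_le_sum fun i _ => (ramp_le_abs_div hγ _).trans ?_
    rw [abs_mul, div_mul_eq_mul_div]
    refine div_le_div_of_nonneg_right ?_ hγ.le
    exact (mul_le_of_le_one_left (abs_nonneg _) (abs_sign_le_one _)).trans (hH.abs_apply_le f _)
  calc (∑ i, ramp γ (Real.sign (z i).2 * f (z i).1)) / n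
      ≤ (‖f‖ / γ * (√n * √(∑ i, k (z i).1 (z i).1))) / n :=
        div_le_div_of_nonneg_right
          (h1.trans (mul_le_mul_of_nonneg_left hcs (by positivity))) hn0.le
    _ = ‖f‖ * √(∑ i, k (z i).1 (z i).1) / (γ * √n) := by
        field_simp
        rw [hsq]
        ring

/-- For small samples the margin bound is trivial. -/
theorem IsRKHSOfKernel.margin_bound_of_small (hH : IsRKHSOfKernel H k) {γ : ℝ} (hγ : 0 < γ)
    {n : ℕ} [NeZero n] {a : ℝ} (ha : 0 < a) (hn : √(n : ℝ) ≤ 2 + 3 * (√n * a))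
    (z : Fin n → 𝒳 × ℝ) (f : H) :
    (∑ i, ramp γ (Real.sign (z i).2 * f (z i).1)) / n
      ≤ 2 * ‖f‖ * √(∑ i, k (z i).1 (z i).1) / (γ * n) + 3 * a := by
  have hn0 : (0 : ℝ) < n := Nat.cast_pos.2 (NeZero.pos n)
  set r := √(n : ℝ) with hr
  have hr0 : 0 < r := Real.sqrt_pos.2 hn0
  have hsq : r ^ 2 = n := Real.sq_sqrt hn0.le
  set s := ‖f‖ * √(∑ i, k (z i).1 (z i).1) / (γ * r) with hs
  set A := (∑ i, ramp γ (Real.sign (z i).2 * f (z i).1)) / n with hA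
  have hs0 : 0 ≤ s := by positivity
  have hAs : A ≤ s := hH.average_ramp_le hγ z f
  have hA1 : A ≤ 1 := by
    rw [hA, div_le_one hn0]
    refine (Finset.sum_le_sum fun i _ => ramp_le_one γ _).trans ?_
    simp
  have hpen : 2 * ‖f‖ * √(∑ i, k (z i).1 (z i).1) / (γ * n) = 2 * s / r := by
    rw [hs, ← hsq]; field_simp
  rw [hpen]
  by_contra hlt
  have hlt' := not_le.1 hlt
  have h1 : 2 * s + 3 * (r * a) < r := by
    have h := mul_lt_mul_of_pos_right (hlt'.trans_le hA1) hr0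
    rw [add_mul, div_mul_cancel₀ _ hr0.ne'] at h
    linarith
  have h2 : 2 * s + 3 * (r * a) < s * r := by
    have h := mul_lt_mul_of_pos_right (hlt'.trans_le hAs) hr0
    rw [add_mul, div_mul_cancel₀ _ hr0.ne'] at h
    linarith
  have hra : 0 < r * a := mul_pos hr0 ha
  have hs1 : s < 1 := by linarith
  -- For `r ≤ 2`, `h2` contradicts `sr ≤ 2s`. For `r ≥ 2`, it gives `3ra < s(r-2) ≤ r-2`, against
  -- `hn`.
  rcases le_total r 2 with h3 | h3
  · nlinarith
  · nlinarith

/-- The minimum-norm interpolant of the labels. -/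
theorem IsRKHSOfKernel.exists_interpolant (hH : IsRKHSOfKernel H k) {n : ℕ} (x : Fin n → 𝒳)
    (y : Fin n → ℝ) (hK : IsUnit (kernelMatrix k x)) :
    ∃ g : H, (∀ i, g (x i) = y i) ∧ ‖g‖ ^ 2 = y ⬝ᵥ ((kernelMatrix k x)⁻¹ *ᵥ y) := by
  set c := (kernelMatrix k x)⁻¹ *ᵥ y with hc
  have hKc : kernelMatrix k x *ᵥ c = y := by
    rw [hc, Matrix.mulVec_mulVec, Matrix.mul_nonsing_inv _ ((Matrix.isUnit_iff_isUnit_det _).1 hK),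
      Matrix.one_mulVec]
  set g : H := ∑ j, c j • RKHS.kerFun H (x j) (1 : ℝ) with hg
  have hval : ∀ i, g (x i) = y i := fun i => by
    rw [← inner_kerFun_one, hg, sum_inner, ← congrFun hKc i]
    simp only [inner_smul_left, hH.inner_kerFun, Matrix.mulVec, dotProduct, kernelMatrix,
      Matrix.of_apply, RCLike.conj_to_real]
    exact Finset.sum_congr rfl fun j _ => mul_comm _ _
  refine ⟨g, hval, ?_⟩
  rw [← real_inner_self_eq_norm_sq]
  conv_lhs => rw [hg, inner_sum]
  simp only [inner_smul_right, inner_kerFun_one]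
  rw [dotProduct]
  refine Finset.sum_congr rfl fun j _ => ?_
  rw [← hg, hval, mul_comm]

/-- The interpolant is a competitor with zero empirical loss, and losses are nonnegative, so
comparing objectives leaves only the two penalties. -/
theorem IsRKHSOfKernel.norm_le_of_isKernelSolution (hH : IsRKHSOfKernel H k) {n : ℕ}
    {x : Fin n → 𝒳} {y : Fin n → ℝ} (hK : IsUnit (kernelMatrix k x)) {ℓ : ℝ → ℝ → ℝ}
    {𝒴 : Set ℝ} (hy : ∀ i, y i ∈ 𝒴) (hℓ_nonneg : ∀ u : ℝ, ∀ y ∈ 𝒴, 0 ≤ ℓ u y)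
    (hℓ_diag : ∀ y ∈ 𝒴, ℓ y y = 0) {lam : ℝ} (hlam : 0 < lam) {f : H}
    (hf : IsKernelSolution ℓ lam x y f) :
    ‖f‖ ≤ √(y ⬝ᵥ ((kernelMatrix k x)⁻¹ *ᵥ y)) := by
  obtain ⟨g, hg, hgn⟩ := hH.exists_interpolant x y hK
  have h1 := hf g
  unfold regularizedLoss at h1
  have h2 : ∑ i, ℓ (g (x i)) (y i) = 0 := Finset.sum_eq_zero fun i _ => by
    rw [hg, hℓ_diag _ (hy i)]
  have h3 : 0 ≤ (1 / (n : ℝ)) * ∑ i, ℓ (f (x i)) (y i) :=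
    mul_nonneg (by positivity) (Finset.sum_nonneg fun i _ => hℓ_nonneg _ _ (hy i))
  rw [h2, hgn] at h1
  refine Real.le_sqrt_of_sq_le ?_
  have h4 : lam / 2 * ‖f‖ ^ 2 ≤ lam / 2 * (y ⬝ᵥ ((kernelMatrix k x)⁻¹ *ᵥ y)) := by linarith
  exact le_of_mul_le_mul_left h4 (by positivity)

/-- A vanishing diagonal entry kills the feature vector, hence a whole row. This makes `k(x,x)`
almost surely positive, which keeps the truncated expectation `V` nonzero. -/
theorem IsRKHSOfKernel.self_pos_of_isUnit (hH : IsRKHSOfKernel H k) {n : ℕ} {x : Fin n → 𝒳}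
    (hK : IsUnit (kernelMatrix k x)) (i : Fin n) : 0 < k (x i) (x i) := by
  refine lt_of_le_of_ne (hH.self_nonneg _) fun h => ?_
  have h0 : RKHS.kerFun H (x i) (1 : ℝ) = 0 := by
    have := hH.norm_kerFun_sq (x i)
    rw [← h] at this
    simpa using this
  have hrow : ∀ j, kernelMatrix k x i j = 0 := fun j => by
    change k (x i) (x j) = 0
    rw [← hH.inner_kerFun (x j) (x i), h0, inner_zero_right]
  have := (Matrix.isUnit_iff_isUnit_det _).1 hK
  rw [Matrix.det_eq_zero_of_row_eq_zero i hrow] at this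
  simp at this

theorem isUnit_of_rank_eq {n : ℕ} {A : Matrix (Fin n) (Fin n) ℝ} (h : A.rank = n) : IsUnit A := by
  rw [← Matrix.mulVec_surjective_iff_isUnit]
  have : LinearMap.range A.mulVecLin = ⊤ :=
    Submodule.eq_top_of_finrank_eq (by rw [← Matrix.rank, h]; simp)
  exact LinearMap.range_eq_top.1 this

variable [MeasurableSpace 𝒳]

/-- The margin bound, uniform over the reproducing kernel Hilbert space, for large samples. -/
theorem IsRKHSOfKernel.exists_uniform_margin_bound_of_large (hH : IsRKHSOfKernel H k)
    (hk : Measurable (Function.uncurry k)) {κ : ℝ} (hκ : ∀ x, k x x ≤ κ) {γ : ℝ} (hγ : 0 < γ)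
    (P : Measure (𝒳 × ℝ)) [IsProbabilityMeasure P] (hpos : ∀ᵐ z ∂P, 0 < k z.1 z.1) {n : ℕ}
    [NeZero n] (hn : 15 / 4 ≤ √(n : ℝ)) {a : ℝ} (ha : 0 < a) (ha1 : a < 1)
    (hL : Real.log 2 ≤ 2 * n * a ^ 2) :
    ∃ B : Set (Fin n → 𝒳 × ℝ), MeasurableSet B ∧
      (Measure.pi fun _ => P).real B ≤ 2 * Real.exp (-(2 * n * a ^ 2)) ∧
      ∀ z, z ∉ B → ∀ f : H, (∑ i, ramp γ (Real.sign (z i).2 * f (z i).1)) / n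
          - ∫ z, ramp γ (Real.sign z.2 * f z.1) ∂P
        ≤ 2 * ‖f‖ * √(∑ i, k (z i).1 (z i).1) / (γ * n) + 3 * a := by
  have hn0 : (0 : ℝ) < n := Nat.cast_pos.2 (NeZero.pos n)
  have hsn : 0 < √(n : ℝ) := Real.sqrt_pos.2 hn0
  have hsq : √(n : ℝ) ^ 2 = n := Real.sq_sqrt hn0.le
  have hk0 := hH.self_nonneg
  have hdm := measurable_kernel_diag (𝒳 := 𝒳) hk
  obtain ⟨θ, w, hθ0, hwm, hw0, hw1, hwa, hwτ⟩ :=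
    exists_truncation P hdm (fun z => hk0 z.1) ha ha1
  have hwabs : ∀ z, |w z| ≤ 1 := fun z => by rw [abs_of_nonneg (hw0 z)]; exact hw1 z
  have hwi : Integrable w P := integrable_of_forall_abs_le hwm hwabs
  have hwi' : Integrable (fun z => 1 - w z) P := (integrable_const _).sub hwi
  have hmin0 : ∀ z : 𝒳 × ℝ, 0 ≤ min (k z.1 z.1) θ := fun z => le_min (hk0 _) hθ0
  have hminm : Measurable fun z : 𝒳 × ℝ => min (k z.1 z.1) θ := hdm.min measurable_const
  have hmini : Integrable (fun z : 𝒳 × ℝ => min (k z.1 z.1) θ) P :=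
    integrable_of_forall_abs_le (C := θ) hminm fun z => by
      rw [abs_of_nonneg (hmin0 z)]; exact min_le_right _ _
  set V := ∫ z, w z * k z.1 z.1 ∂P with hVdef
  have hV : V = ∫ z, min (k z.1 z.1) θ ∂P - θ * a := by
    rw [hVdef]
    simp only [hwτ]
    rw [integral_sub hmini (hwi'.mul_const _), integral_mul_const, hwa]
    ring
  have hwki : Integrable (fun z : 𝒳 × ℝ => w z * k z.1 z.1) P := by
    simp only [hwτ]
    exact hmini.sub (hwi'.mul_const _)
  have hVpos : 0 < V := by
    have hV0 : 0 ≤ V := integral_nonneg fun z => mul_nonneg (hw0 z) (hk0 _)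
    refine lt_of_le_of_ne hV0 fun h => ?_
    have hae := (integral_eq_zero_iff_of_nonneg (fun z => mul_nonneg (hw0 z) (hk0 _)) hwki).1 h.symm
    have hone : ∫ z, (1 - w z) ∂P = ∫ _, (1 : ℝ) ∂P := by
      refine integral_congr_ae ?_
      filter_upwards [hae, hpos] with z hz hz'
      have : w z = 0 := by
        simpa [hz'.ne'] using hz
      rw [this, sub_zero]
    rw [hwa] at hone
    simp at hone
    linarith
  have hθ : 0 < θ := by
    refine lt_of_le_of_ne hθ0 fun h => ?_
    have : ∫ z : 𝒳 × ℝ, min (k z.1 z.1) θ ∂P = 0 := by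
      rw [← h]
      simp [hk0]
    rw [this, ← h] at hV
    simp at hV
    linarith
  have hsV : 0 < √V := Real.sqrt_pos.2 hVpos
  -- Radii chosen so that `2Λ_j√V/(γ√n) = (j+1)a/2`: the penalty grows by `a/2` per shell, the
  -- expected supremum only by `3a/10`.
  set Λ : ℕ → ℝ := fun j => (j + 1) * (a / 2) * (γ * √n) / (2 * √V) with hΛ
  have hΛpos : ∀ j, 0 < Λ j := fun j => by positivity
  have hM : ∀ j, 6 / 5 * (Λ j * √V / (γ * √n)) = 3 / 10 * (j + 1) * a := fun j => by
    rw [hΛ]; field_simp; norm_num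
  -- The threshold is the least penalty on shell `j` plus `2a`; the third `a` is reserved for the
  -- truncated mass.
  have hdev := fun j : ℕ => hH.exists_margin_deviation hk hκ hγ P hwm hw0 hw1 hn (hΛpos j)
    (t := j * (a / 2) + 2 * a) (by
      rw [hM]
      have : (0 : ℝ) ≤ j := Nat.cast_nonneg j
      nlinarith)
  simp only [← hVdef, hM] at hdev
  choose B hBm hBle hB using hdev
  -- Once the penalty reaches `1` the claim is trivial, so about `2/a` shells of width `a/2` are
  -- enough.
  set J : ℕ := ⌈2 / a⌉₊ + 1 with hJ
  set G : 𝒳 × ℝ → ℝ := fun z => min (k z.1 z.1) θ / θ with hG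
  set B' : Set (Fin n → 𝒳 × ℝ) := {z | ∑ i, G (z i) ≤ n * (∫ x, G x ∂P - a)} with hB'
  have hGm : Measurable G := hminm.div_const _
  have hB'le := measureReal_average_le P (n := n) hGm (fun z => div_nonneg (hmin0 z) hθ0)
    (fun z => (div_le_one hθ).2 (min_le_right _ _)) ha.le
  have hB'm : MeasurableSet B' := measurableSet_le
    (Finset.measurable_sum _ fun i _ => hGm.comp (measurable_pi_apply i)) measurable_const
  refine ⟨(⋃ j ∈ Finset.range J, B j) ∪ B',
    (Finset.measurableSet_biUnion _ fun j _ => hBm j).union hB'm, ?_, ?_⟩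
  · have hsum : ∑ j ∈ Finset.range J, (Measure.pi fun _ : Fin n => P).real (B j)
        ≤ Real.exp (-(2 * n * a ^ 2)) := by
      refine le_trans (Finset.sum_le_sum fun j _ => (hBle j).trans ?_) (sum_range_exp_le hL J)
      refine Real.exp_le_exp.2 (neg_le_neg ?_)
      have hj : (0 : ℝ) ≤ j := Nat.cast_nonneg j
      have h1 : (j * (a / 2) + 2 * a - 3 / 10 * (j + 1) * a) = a * (17 / 10 + 1 / 5 * j) := by ring
      rw [h1]
      have h2 : 14 / 5 + 3 / 5 * (j : ℝ) ≤ (17 / 10 + 1 / 5 * j) ^ 2 / (101 / 100) := by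
        rw [le_div_iff₀ (by norm_num)]
        nlinarith
      calc 2 * n * a ^ 2 * (14 / 5 + 3 / 5 * (j : ℝ))
          ≤ 2 * n * a ^ 2 * ((17 / 10 + 1 / 5 * j) ^ 2 / (101 / 100)) :=
            mul_le_mul_of_nonneg_left h2 (by positivity)
        _ = _ := by ring
    calc (Measure.pi fun _ : Fin n => P).real ((⋃ j ∈ Finset.range J, B j) ∪ B')
        ≤ (Measure.pi fun _ : Fin n => P).real (⋃ j ∈ Finset.range J, B j)
          + (Measure.pi fun _ : Fin n => P).real B' := measureReal_union_le _ _
      _ ≤ Real.exp (-(2 * n * a ^ 2)) + Real.exp (-(2 * n * a ^ 2)) :=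
          add_le_add ((measureReal_biUnion_finset_le _ _).trans hsum) hB'le
      _ = _ := by ring
  · intro z hz f
    have hzB : ∀ j < J, z ∉ B j := fun j hj hzj =>
      hz (Or.inl (Set.mem_biUnion (Finset.mem_coe.2 (Finset.mem_range.2 hj)) hzj))
    have hzB' : n * (∫ x, G x ∂P - a) < ∑ i, G (z i) := not_le.1 fun h => hz (Or.inr h)
    set T := ∑ i, k (z i).1 (z i).1 with hT
    -- Capping at `θ` gives variables in `[0, 1]` after scaling, and a deviation of `a` then costs
    -- exactly the `θa` by which `V` falls short of the capped expectation.
    have hTV : n * V ≤ T := by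
      have h1 : ∫ x, G x ∂P = (∫ x, min (k x.1 x.1) θ ∂P) / θ := integral_div _ _
      have h2 : ∑ i, G (z i) = (∑ i, min (k (z i).1 (z i).1) θ) / θ := by
        rw [hG, Finset.sum_div]
      rw [h1, h2, lt_div_iff₀ hθ] at hzB'
      have h3 : n * ((∫ x, min (k x.1 x.1) θ ∂P) / θ - a) * θ = n * V := by
        rw [hV]; field_simp
      rw [h3] at hzB'
      exact hzB'.le.trans (Finset.sum_le_sum fun i _ => min_le_left _ _)
    have hsT : √n * √V ≤ √T := by
      rw [← Real.sqrt_mul hn0.le]; exact Real.sqrt_le_sqrt hTV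
    set q := 2 * ‖f‖ * √V / (γ * √n) with hq
    have hq0 : 0 ≤ q := by positivity
    have hqT : q ≤ 2 * ‖f‖ * √T / (γ * n) := by
      calc q = 2 * ‖f‖ * (√n * √V) / (γ * n) := by
            rw [hq]; nth_rewrite 3 [← hsq]; field_simp
        _ ≤ _ := div_le_div_of_nonneg_right
            (mul_le_mul_of_nonneg_left hsT (by positivity)) (by positivity)
    set ρ : 𝒳 × ℝ → ℝ := fun z => ramp γ (Real.sign z.2 * f z.1) with hρ
    have hρ0 : ∀ z, 0 ≤ ρ z := fun z => ramp_nonneg _ _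
    have hρ1 : ∀ z, ρ z ≤ 1 := fun z => ramp_le_one _ _
    have hρm : Measurable ρ := hH.measurable_margin hk γ f
    have hρi : Integrable ρ P := integrable_of_forall_abs_le (C := 1) hρm fun z => by
      rw [abs_of_nonneg (hρ0 z)]; exact hρ1 z
    have hρint : 0 ≤ ∫ z, ρ z ∂P := integral_nonneg hρ0
    change (∑ i, ρ (z i)) / n - ∫ z, ρ z ∂P ≤ _
    rcases le_total 1 q with hq1 | hq1
    · have : (∑ i, ρ (z i)) / n ≤ 1 := by
        rw [div_le_one hn0]
        refine (Finset.sum_le_sum fun i _ => hρ1 _).trans ?_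
        simp
      linarith
    · set j : ℕ := ⌊q / (a / 2)⌋₊ with hj
      have ha2 : 0 < a / 2 := by positivity
      have hj1 : j * (a / 2) ≤ q := by
        rw [← le_div_iff₀ ha2]; exact Nat.floor_le (by positivity)
      have hj2 : q ≤ (j + 1) * (a / 2) := by
        rw [← div_le_iff₀ ha2]; exact (Nat.lt_floor_add_one _).le
      have hjJ : j < J := by
        refine Nat.lt_succ_of_le ((Nat.floor_le_ceil _).trans (Nat.ceil_mono ?_))
        rw [div_le_div_iff₀ ha2 ha]
        nlinarith
      have hfΛ : ‖f‖ ≤ Λ j := by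
        rw [hΛ]
        simp only
        rw [le_div_iff₀ (by positivity)]
        rw [hq, div_le_iff₀ (by positivity)] at hj2
        linarith
      have hmain := hB j z (hzB j hjJ) f hfΛ
      change (∑ i, (w (z i) * ρ (z i) + (1 - w (z i)))) / n
        - ∫ z, (w z * ρ z + (1 - w z)) ∂P < _ at hmain
      have hwρi : Integrable (fun z => w z * ρ z) P :=
        integrable_of_forall_abs_le (C := 1) (hwm.mul hρm) fun z => by
          rw [abs_of_nonneg (mul_nonneg (hw0 z) (hρ0 z))]
          exact (mul_le_of_le_one_right (hw0 z) (hρ1 z)).trans (hw1 z)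
      -- Replacing the ramp by `w·ρ + (1 - w)` can only raise the sample mean and raises the
      -- expectation by at most `a`.
      rw [integral_add hwρi hwi', hwa] at hmain
      have h1 : ∫ z, w z * ρ z ∂P ≤ ∫ z, ρ z ∂P :=
        integral_mono hwρi hρi fun z => mul_le_of_le_one_left (hρ0 z) (hw1 z)
      have h2 : (∑ i, ρ (z i)) / n ≤ (∑ i, (w (z i) * ρ (z i) + (1 - w (z i)))) / n := by
        refine div_le_div_of_nonneg_right (Finset.sum_le_sum fun i _ => ?_) hn0.le
        nlinarith [hw1 (z i), hρ1 (z i), hw0 (z i), hρ0 (z i)]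
      linarith

/-- The margin bound, uniform over the reproducing kernel Hilbert space. -/
theorem IsRKHSOfKernel.exists_uniform_margin_bound (hH : IsRKHSOfKernel H k)
    (hk : Measurable (Function.uncurry k)) {κ : ℝ} (hκ : ∀ x, k x x ≤ κ) {γ : ℝ} (hγ : 0 < γ)
    (P : Measure (𝒳 × ℝ)) [IsProbabilityMeasure P] (hpos : ∀ᵐ z ∂P, 0 < k z.1 z.1) {n : ℕ}
    [NeZero n] {a : ℝ} (ha : 0 < a) (hL : Real.log 2 ≤ 2 * n * a ^ 2) :
    ∃ B : Set (Fin n → 𝒳 × ℝ), MeasurableSet B ∧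
      (Measure.pi fun _ => P).real B ≤ 2 * Real.exp (-(2 * n * a ^ 2)) ∧
      ∀ z, z ∉ B → ∀ f : H, (∑ i, ramp γ (Real.sign (z i).2 * f (z i).1)) / n
          - ∫ z, ramp γ (Real.sign z.2 * f z.1) ∂P
        ≤ 2 * ‖f‖ * √(∑ i, k (z i).1 (z i).1) / (γ * n) + 3 * a := by
  have hn0 : (0 : ℝ) < n := Nat.cast_pos.2 (NeZero.pos n)
  have hsn : 0 < √(n : ℝ) := Real.sqrt_pos.2 hn0
  rcases le_total (√(n : ℝ)) (2 + 3 * (√n * a)) with hs | hs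
  · refine ⟨∅, MeasurableSet.empty, by simp [Real.exp_nonneg], fun z _ f => ?_⟩
    have h1 : 0 ≤ ∫ z, ramp γ (Real.sign z.2 * f z.1) ∂P :=
      integral_nonneg fun z => ramp_nonneg _ _
    linarith [hH.margin_bound_of_small hγ ha hs z f]
  · have hsq : √(n : ℝ) ^ 2 = n := Real.sq_sqrt hn0.le
    -- `(7/12)² < (log 2)/2`, and `2 + 3·(7/12) = 15/4` is the lower bound on `√n` required for
    -- large samples.
    have hb : 7 / 12 ≤ √n * a := by
      have h1 : Real.log 2 ≤ 2 * (√n * a) ^ 2 := by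
        rw [mul_pow, hsq]; linarith
      have h2 := Real.log_two_gt_d9
      have h3 : 0 < √n * a := mul_pos hsn ha
      nlinarith
    refine hH.exists_uniform_margin_bound_of_large hk hκ hγ P hpos (by linarith) ha ?_ hL
    by_contra h1
    nlinarith [not_lt.1 h1]

end Margin

/-! ### Transfer to the training sample -/

theorem theorem1 {𝒳 H Ω : Type*} [MeasurableSpace 𝒳] [MeasurableSpace Ω]
    [NormedAddCommGroup H] [InnerProductSpace ℝ H] [CompleteSpace H] [RKHS ℝ H 𝒳 ℝ]
    -- the kernel, its RKHS `H`, and the supremum of its diagonal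
    (k : 𝒳 → 𝒳 → ℝ) (hk : Measurable (Function.uncurry k)) (hH : IsRKHSOfKernel H k)
    (κ : ℝ) (hκ : IsLUB (Set.range fun x => k x x) κ)
    -- the label set and the distribution of an example
    (𝒴 : Set ℝ) (P : Measure (𝒳 × ℝ)) [IsProbabilityMeasure P] (hP : ∀ᵐ z ∂P, z.2 ∈ 𝒴)
    -- the i.i.d. training sample
    (n : ℕ) (hn : 0 < n) (μ : Measure Ω) [IsProbabilityMeasure μ]
    (X : Fin n → Ω → 𝒳) (Y : Fin n → Ω → ℝ)
    (hlaw : ∀ i, HasLaw (fun ω => (X i ω, Y i ω)) P μ)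
    (hindep : iIndepFun (fun i ω => (X i ω, Y i ω)) μ)
    (hrank : ∀ᵐ ω ∂μ, (kernelMatrix k (fun i => X i ω)).rank = n)
    -- the loss function; predictions are real numbers, targets lie in `𝒴`
    (ℓ : ℝ → ℝ → ℝ) (hℓ_nonneg : ∀ u : ℝ, ∀ y ∈ 𝒴, 0 ≤ ℓ u y) (hℓ_diag : ∀ y ∈ 𝒴, ℓ y y = 0)
    (lam : ℝ) (hlam : 0 < lam) (γ : ℝ) (hγ : 0 < γ) (δ : ℝ) (hδ : 0 < δ) :
    ∃ E : Set Ω, MeasurableSet E ∧ 1 - δ ≤ μ.real E ∧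
      ∀ ω ∈ E, ∀ f : H,
        IsKernelSolution ℓ lam (fun i => X i ω) (fun i => Y i ω) f →
          P.real {z | z.2 * f z.1 ≤ 0} ≤
            (1 / (n : ℝ)) * ∑ i, marginLoss γ (Real.sign (Y i ω) * f (X i ω))
            + (2 * √((fun i => Y i ω) ⬝ᵥ
                  ((kernelMatrix k (fun i => X i ω))⁻¹ *ᵥ (fun i => Y i ω))) + 2) / (γ * n)
                * √((kernelMatrix k (fun i => X i ω)).trace)
            + 3 * √(Real.log (2 * (⌈γ * √(n : ℝ) / (2 * √κ)⌉₊ : ℝ) / δ) / (2 * n)) := by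
  have : NeZero n := ⟨hn.ne'⟩
  have hn0 : (0 : ℝ) < n := Nat.cast_pos.2 hn
  have hκle : ∀ x, k x x ≤ κ := fun x => hκ.1 ⟨x, rfl⟩
  -- For `δ ≥ 1` the empty event will do; otherwise `log(2/δ) > log 2`, as the summation over shells
  -- requires.
  rcases le_or_gt 1 δ with hδ1 | hδ1
  · exact ⟨∅, MeasurableSet.empty, by simpa using hδ1, fun ω hω => absurd hω (Set.notMem_empty ω)⟩
  have hunit : ∀ᵐ ω ∂μ, IsUnit (kernelMatrix k fun i => X i ω) := by
    filter_upwards [hrank] with ω hω using isUnit_of_rank_eq hω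
  have hκ0 : 0 < κ := by
    obtain ⟨ω, hω⟩ := hunit.exists
    exact (hH.self_pos_of_isUnit hω ⟨0, hn⟩).trans_le (hκle _)
  have hpos : ∀ᵐ z ∂P, 0 < k z.1 z.1 := by
    rw [← (hlaw ⟨0, hn⟩).map_eq]
    refine (ae_map_iff (hlaw ⟨0, hn⟩).aemeasurable
      (measurableSet_lt measurable_const (measurable_kernel_diag hk))).2 ?_
    filter_upwards [hunit] with ω hω using hH.self_pos_of_isUnit hω ⟨0, hn⟩
  have hYmem : ∀ᵐ ω ∂μ, ∀ i, Y i ω ∈ 𝒴 := by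
    rw [ae_all_iff]
    intro i
    have h1 := hP
    rw [← (hlaw i).map_eq] at h1
    exact ae_of_ae_map (hlaw i).aemeasurable h1
  set a := √(Real.log (2 / δ) / (2 * n)) with ha
  have hlog : Real.log 2 < Real.log (2 / δ) :=
    Real.log_lt_log two_pos ((lt_div_iff₀ hδ).2 (by linarith))
  have hlog2 : 0 < Real.log 2 := Real.log_pos one_lt_two
  have hapos : 0 < a := Real.sqrt_pos.2 (div_pos (by linarith) (by positivity))
  have hasq : 2 * n * a ^ 2 = Real.log (2 / δ) := by
    rw [ha, Real.sq_sqrt (div_nonneg (by linarith) (by positivity))]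
    field_simp
  obtain ⟨B, hBm, hBle, hB⟩ := hH.exists_uniform_margin_bound hk hκle hγ P hpos (n := n) hapos
    (by rw [hasq]; exact hlog.le)
  have hBδ : (Measure.pi fun _ : Fin n => P).real B ≤ δ := by
    refine hBle.trans (le_of_eq ?_)
    rw [hasq, Real.exp_neg, Real.exp_log (by positivity)]
    field_simp
  set Z : Ω → Fin n → 𝒳 × ℝ := fun ω i => (X i ω, Y i ω) with hZ
  have hZm : AEMeasurable Z μ := aemeasurable_pi_lambda _ fun i => (hlaw i).aemeasurable
  have hZlaw : μ.map Z = Measure.pi fun _ => P := by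
    rw [hZ, (iIndepFun_iff_map_fun_eq_pi_map fun i => (hlaw i).aemeasurable).1 hindep]
    congr 1
    ext1 i
    exact (hlaw i).map_eq
  set bad : Set Ω := Z ⁻¹' B ∪
    {ω | ¬ (IsUnit (kernelMatrix k fun i => X i ω) ∧ ∀ i, Y i ω ∈ 𝒴)} with hbad
  have hbadle : μ bad ≤ ENNReal.ofReal δ := by
    have hnull : μ {ω | ¬ (IsUnit (kernelMatrix k fun i => X i ω) ∧ ∀ i, Y i ω ∈ 𝒴)} = 0 :=
      ae_iff.1 (hunit.and hYmem)
    refine (measure_union_le _ _).trans ?_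
    rw [hnull, add_zero, ← Measure.map_apply_of_aemeasurable hZm hBm, hZlaw]
    rw [← ENNReal.ofReal_toReal (measure_ne_top (Measure.pi fun _ : Fin n => P) B)]
    exact ENNReal.ofReal_le_ofReal hBδ
  -- The sample map is only a.e. measurable, so the bad event is enlarged to a measurable hull of
  -- equal measure.
  refine ⟨(toMeasurable μ bad)ᶜ, (measurableSet_toMeasurable _ _).compl, ?_, ?_⟩
  · rw [probReal_compl_eq_one_sub (measurableSet_toMeasurable _ _)]
    have : μ.real (toMeasurable μ bad) ≤ δ := by
      rw [Measure.real, measure_toMeasurable]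
      exact ENNReal.toReal_le_of_le_ofReal hδ.le hbadle
    linarith
  · intro ω hω f hf
    have hωbad : ω ∉ bad := fun h => hω (subset_toMeasurable μ bad h)
    have hωB : Z ω ∉ B := fun h => hωbad (Or.inl h)
    obtain ⟨hK, hYω⟩ := not_not.1 fun h => hωbad (Or.inr h)
    have hnorm := hH.norm_le_of_isKernelSolution hK hYω hℓ_nonneg hℓ_diag hlam hf
    have hmain := hB (Z ω) hωB f
    set Q := √((fun i => Y i ω) ⬝ᵥ
      ((kernelMatrix k (fun i => X i ω))⁻¹ *ᵥ (fun i => Y i ω))) with hQ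
    have htr : ∑ i, k (Z ω i).1 (Z ω i).1 = (kernelMatrix k (fun i => X i ω)).trace := rfl
    rw [htr] at hmain
    set T := (kernelMatrix k (fun i => X i ω)).trace with hT
    have hpen : 2 * ‖f‖ * √T / (γ * n) ≤ (2 * Q + 2) / (γ * n) * √T := by
      rw [div_mul_eq_mul_div]
      refine div_le_div_of_nonneg_right (mul_le_mul_of_nonneg_right (by linarith)
        (Real.sqrt_nonneg _)) (by positivity)
    -- `κ > 0` forces `M₀ ≥ 1`, so replacing `log(2/δ)` by `log(2M₀/δ)` only weakens the bound.
    have hceil : (1 : ℝ) ≤ (⌈γ * √(n : ℝ) / (2 * √κ)⌉₊ : ℝ) := by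
      have h1 : 0 < ⌈γ * √(n : ℝ) / (2 * √κ)⌉₊ := Nat.ceil_pos.2 (by positivity)
      exact_mod_cast h1
    have hlogle : a ≤ √(Real.log (2 * (⌈γ * √(n : ℝ) / (2 * √κ)⌉₊ : ℝ) / δ) / (2 * n)) := by
      refine Real.sqrt_le_sqrt (div_le_div_of_nonneg_right (Real.log_le_log (by positivity) ?_)
        (by positivity))
      exact div_le_div_of_nonneg_right (by linarith) hδ.le
    have hemp : (1 / (n : ℝ)) * ∑ i, marginLoss γ (Real.sign (Y i ω) * f (X i ω))
        = 1 - (∑ i, ramp γ (Real.sign (Z ω i).2 * f (Z ω i).1)) / n := by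
      simp only [ramp_eq_one_sub_marginLoss hγ, Finset.sum_sub_distrib, hZ]
      simp
      field_simp
      ring
    have hrm := hH.measurable_margin hk γ f
    have hri : Integrable (fun z : 𝒳 × ℝ => ramp γ (Real.sign z.2 * f z.1)) P :=
      integrable_of_forall_abs_le (C := 1) hrm fun z => by
        rw [abs_of_nonneg (ramp_nonneg _ _)]; exact ramp_le_one _ _
    have hrisk : P.real {z | z.2 * f z.1 ≤ 0}
        ≤ 1 - ∫ z, ramp γ (Real.sign z.2 * f z.1) ∂P := by
      have hS : MeasurableSet {z : 𝒳 × ℝ | z.2 * f z.1 ≤ 0} :=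
        measurableSet_le (measurable_snd.mul ((hH.measurable_coe hk f).comp measurable_fst))
          measurable_const
      have h1 : ∫ z, ({z : 𝒳 × ℝ | z.2 * f z.1 ≤ 0}.indicator (fun _ => (1 : ℝ)) z) ∂P
          ≤ ∫ z, (1 - ramp γ (Real.sign z.2 * f z.1)) ∂P := by
        refine integral_mono ((integrable_const _).indicator hS) ((integrable_const _).sub hri)
          fun z => ?_
        by_cases hz : z.2 * f z.1 ≤ 0
        · rw [Set.indicator_of_mem (by exact hz), ramp_of_nonpos hγ (sign_mul_nonpos hz), sub_zero]
        · rw [Set.indicator_of_notMem (by exact hz), sub_nonneg]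
          exact ramp_le_one _ _
      rw [integral_indicator_const _ hS, integral_sub (integrable_const _) hri] at h1
      simpa using h1
    rw [hemp]
    linarith
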